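/- Let $\Omega\subset\mathbf R^2$ be a bounded Lipschitz domain (nonempty, open, connected, bounded, and near each boundary point, in a suitable Cartesian coordinate system, the region above the graph of a Lipschitz function). Let $\Gamma_D\subset\partial\Omega$ be relatively closed, of positive surface measure, with finitely many connected components and at least one interior point relative to $\partial\Omega$; put $\Gamma:=\partial\Omega\setminus\Gamma_D$. Let $$[H^1_\Gamma(\Omega)]^2:=\{\mathbf u\in[H^1(\Omega)]^2:\ \mathbf u|_{\Gamma_D}=0\}$$ in the sense of traces, and for $\mathbf u=(u_1,u_2)\in[H^1(\Omega)]^2$ let $\mathcal B\mathbf u:=(-\partial_x u_1+\partial_y u_2,\ \partial_y u_1+\partial_x u_2)$ (weak derivatives) be the Cauchy–Riemann operator and $\partial\mathbf u$ the weak Jacobian matrix. Let $\mathbf g\in[L^2(\partial\Omega)]^2$ and $\alpha>0$. Then the problem $$\min_{\mathbf u\in[H^1_\Gamma(\Omega)]^2}\ \frac12\Big(\|\mathcal B\mathbf u\|_{[L^2(\Omega)]^2}^2+\alpha\|\partial\mathbf u\|_{[L^2(\Omega)]^{2\times2}}^2\Big)-\alpha\int_\Gamma\mathbf g\cdot\mathbf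 u\,ds$$ has exactly one minimiser. Moreover, $\mathbf u\in[H^1_\Gamma(\Omega)]^2$ is the minimiser if and only if $$(\mathcal B\mathbf u,\mathcal B\mathbf v)_{[L^2(\Omega)]^2}+\alpha(\partial\mathbf u,\partial\mathbf v)_{[L^2(\Omega)]^{2\times2}}=\alpha\int_\Gamma\mathbf g\cdot\mathbf v\,ds\qquad\text{for all }\mathbf v\in[H^1_\Gamma(\Omega)]^2 .$$ -/

import Mathlib

open MeasureTheory Filter Topology Set
open scoped ContDiff NNReal ENNReal

noncomputable section

namespace CRLeastSquares

/-- The Euclidean plane `ℝ²`. -/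
abbrev Plane : Type := EuclideanSpace ℝ (Fin 2)

/-- The partial derivative `∂ᵢ φ` of a differentiable function. -/
def partialDeriv (i : Fin 2) (φ : Plane → ℝ) (x : Plane) : ℝ :=
  fderiv ℝ φ x (EuclideanSpace.single i 1)

/-- A bounded Lipschitz domain: nonempty, open, connected, bounded, and near every boundary point,
in a suitable Cartesian coordinate system, the region above the graph of a Lipschitz function. -/
structure IsBoundedLipschitzDomain (Ω : Set Plane) : Prop where
  isOpen : IsOpen Ω
  isConnected : IsConnected Ω
  isBounded : Bornology.IsBounded Ω
  locally_epigraph : ∀ z ∈ frontier Ω,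
    ∃ (e : Plane ≃ₗᵢ[ℝ] Plane) (γ : ℝ → ℝ) (K : ℝ≥0) (r : ℝ),
      LipschitzWith K γ ∧ 0 < r ∧ ∀ x ∈ Metric.ball z r, x ∈ Ω ↔ γ (e x 0) < e x 1

/-- `L²(Ω)`, with respect to Lebesgue measure. -/
abbrev L2 (Ω : Set Plane) : Type := Lp ℝ 2 ((volume : Measure Plane).restrict Ω)

/-- The surface (arc length) measure on `∂Ω`: one-dimensional Hausdorff measure. -/
abbrev surfaceMeasure (Ω : Set Plane) : Measure Plane :=
  (Measure.hausdorffMeasure 1 : Measure Plane).restrict (frontier Ω)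

/-- `L²(∂Ω)`. -/
abbrev BoundaryL2 (Ω : Set Plane) : Type := Lp ℝ 2 (surfaceMeasure Ω)

/-- `p` is the weak partial derivative `∂ᵢ u` in `Ω`. -/
def IsWeakPartial (Ω : Set Plane) (i : Fin 2) (u p : L2 Ω) : Prop :=
  ∀ φ : Plane → ℝ, ContDiff ℝ ∞ φ → HasCompactSupport φ → tsupport φ ⊆ Ω →
    ∫ x in Ω, u x * partialDeriv i φ x = -∫ x in Ω, p x * φ x

theorem integrable_mul_of_hasCompactSupport {Ω : Set Plane} (u : L2 Ω) {f : Plane → ℝ}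
    (hf : Continuous f) (hs : HasCompactSupport f) :
    Integrable (fun x => u x * f x) (volume.restrict Ω) :=
  (Lp.memLp u).integrable_mul (q := 2) ((hf.memLp_of_hasCompactSupport hs).restrict Ω)

theorem continuous_partialDeriv {φ : Plane → ℝ} (hφ : ContDiff ℝ ∞ φ) (i : Fin 2) :
    Continuous (partialDeriv i φ) :=
  (hφ.continuous_fderiv (by simp)).clm_apply continuous_const

theorem hasCompactSupport_partialDeriv {φ : Plane → ℝ} (hs : HasCompactSupport φ) (i : Fin 2) :
    HasCompactSupport (partialDeriv i φ) :=
  hs.fderiv_apply ℝ _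

/-- The Sobolev space `H¹(Ω)`. An element is a function in `L²(Ω)` together with its (uniquely
determined) weak partial derivatives, which are also in `L²(Ω)`. -/
def H1 (Ω : Set Plane) : Submodule ℝ (L2 Ω × (Fin 2 → L2 Ω)) where
  carrier := {u | ∀ i, IsWeakPartial Ω i u.1 (u.2 i)}
  add_mem' := by
    intro u v hu hv i φ hφ hs hsub
    have hd := continuous_partialDeriv hφ i
    have hds := hasCompactSupport_partialDeriv hs i
    have e1 : ∫ x in Ω, (u + v).1 x * partialDeriv i φ x
        = ∫ x in Ω, (u.1 x * partialDeriv i φ x + v.1 x * partialDeriv i φ x) := by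
      apply integral_congr_ae
      filter_upwards [Lp.coeFn_add u.1 v.1] with x hx
      rw [Prod.fst_add, hx, Pi.add_apply, add_mul]
    have e2 : ∫ x in Ω, (u + v).2 i x * φ x
        = ∫ x in Ω, (u.2 i x * φ x + v.2 i x * φ x) := by
      apply integral_congr_ae
      filter_upwards [Lp.coeFn_add (u.2 i) (v.2 i)] with x hx
      rw [Prod.snd_add, Pi.add_apply, hx, Pi.add_apply, add_mul]
    rw [e1, e2,
      integral_add (integrable_mul_of_hasCompactSupport _ hd hds)
        (integrable_mul_of_hasCompactSupport _ hd hds),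
      integral_add (integrable_mul_of_hasCompactSupport _ hφ.continuous hs)
        (integrable_mul_of_hasCompactSupport _ hφ.continuous hs),
      hu i φ hφ hs hsub, hv i φ hφ hs hsub]
    ring
  zero_mem' := by
    intro i φ hφ hs hsub
    have h0 : ∀ f : Plane → ℝ, ∫ x in Ω, (0 : L2 Ω) x * f x = 0 := by
      intro f
      rw [← integral_zero Plane ℝ]
      apply integral_congr_ae
      filter_upwards [Lp.coeFn_zero ℝ 2 ((volume : Measure Plane).restrict Ω)] with x hx
      rw [hx, Pi.zero_apply, zero_mul]
    rw [Prod.fst_zero, Prod.snd_zero, Pi.zero_apply, h0, h0, neg_zero]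
  smul_mem' := by
    intro c u hu i φ hφ hs hsub
    have h0 : ∀ (w : L2 Ω) (f : Plane → ℝ),
        ∫ x in Ω, (c • w) x * f x = c * ∫ x in Ω, w x * f x := by
      intro w f
      rw [← integral_const_mul]
      apply integral_congr_ae
      filter_upwards [Lp.coeFn_smul c w] with x hx
      rw [hx, Pi.smul_apply, smul_eq_mul, mul_assoc]
    rw [Prod.smul_fst, Prod.smul_snd, Pi.smul_apply, h0, h0, hu i φ hφ hs hsub]
    ring

/-- The `L²` function underlying an element of `H¹(Ω)`. -/
def toL2 {Ω : Set Plane} (u : H1 Ω) : L2 Ω := u.1.1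

/-- The weak partial derivative `∂ᵢ u ∈ L²(Ω)` of `u ∈ H¹(Ω)`. -/
def weakPartial {Ω : Set Plane} (i : Fin 2) (u : H1 Ω) : L2 Ω := u.1.2 i

/-- `w ∈ L²(∂Ω)` is the boundary trace of `u ∈ H¹(Ω)`: there are functions `φₙ`, smooth up to the
boundary, with `φₙ → u` in `H¹(Ω)` and `φₙ|_∂Ω → w` in `L²(∂Ω)`. Equivalently, `(u, w)` belongs to
the closure of the graph of the restriction map `φ ↦ φ|_∂Ω`; on a bounded Lipschitz domain that
closure is the graph of the usual trace operator `H¹(Ω) → L²(∂Ω)`. -/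
def HasTrace {Ω : Set Plane} (u : H1 Ω) (w : BoundaryL2 Ω) : Prop :=
  ∃ φ : ℕ → Plane → ℝ, (∀ n, ContDiff ℝ ∞ (φ n)) ∧
    Tendsto (fun n => eLpNorm (fun x => φ n x - toL2 u x) 2 (volume.restrict Ω)) atTop (𝓝 0) ∧
    (∀ i, Tendsto (fun n => eLpNorm (fun x => partialDeriv i (φ n) x - weakPartial i u x) 2
      (volume.restrict Ω)) atTop (𝓝 0)) ∧
    Tendsto (fun n => eLpNorm (fun x => φ n x - w x) 2 (surfaceMeasure Ω)) atTop (𝓝 0)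

open Classical in
/-- The trace `u|_∂Ω` (on a bounded Lipschitz domain every `u ∈ H¹(Ω)` has exactly one; the
default value `0` is irrelevant). -/
def trace {Ω : Set Plane} (u : H1 Ω) : BoundaryL2 Ω :=
  if h : ∃ w, HasTrace u w then h.choose else 0

/-- The space `{u ∈ [H¹(Ω)]² : u = 0 on Γ_D}` of clamped fields, in the sense of traces. -/
def clampedH1 (Ω ΓD : Set Plane) : Set (Fin 2 → H1 Ω) :=
  {u | ∀ j, ∃ w, HasTrace (u j) w ∧
    ∀ᵐ x ∂(Measure.hausdorffMeasure 1 : Measure Plane).restrict ΓD, w x = 0}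

/-- The Cauchy-Riemann operator `(-∂ₓ u₁ + ∂_y u₂, ∂_y u₁ + ∂ₓ u₂)`. -/
def cauchyRiemann {Ω : Set Plane} (u : Fin 2 → H1 Ω) : Fin 2 → L2 Ω :=
  ![-weakPartial 0 (u 0) + weakPartial 1 (u 1), weakPartial 1 (u 0) + weakPartial 0 (u 1)]

/-- The weak Jacobian `(∂u)ᵢⱼ = ∂ⱼ uᵢ`. -/
def jacobian {Ω : Set Plane} (u : Fin 2 → H1 Ω) : Fin 2 → Fin 2 → L2 Ω :=
  fun i j => weakPartial j (u i)

/-- `∫_Γ g · u ds` with `Γ = ∂Ω \ Γ_D`. -/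
def boundaryLoad {Ω : Set Plane} (ΓD : Set Plane) (g : Fin 2 → BoundaryL2 Ω)
    (u : Fin 2 → H1 Ω) : ℝ :=
  ∫ x in frontier Ω \ ΓD, ∑ j, g j x * trace (u j) x ∂(Measure.hausdorffMeasure 1)

/-- The penalised Cauchy-Riemann least-squares functional
`½ (‖Cu‖² + α ‖∂u‖²) - α ∫_Γ g · u ds`. -/
def energy {Ω : Set Plane} (ΓD : Set Plane) (g : Fin 2 → BoundaryL2 Ω) (α : ℝ)
    (u : Fin 2 → H1 Ω) : ℝ :=
  1 / 2 * ((∑ i, ‖cauchyRiemann u i‖ ^ 2) + α * ∑ i, ∑ j, ‖jacobian u i j‖ ^ 2)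
    - α * boundaryLoad ΓD g u

/-- `u` minimises the functional over the clamped fields. -/
def IsMinimiser {Ω : Set Plane} (ΓD : Set Plane) (g : Fin 2 → BoundaryL2 Ω) (α : ℝ)
    (u : Fin 2 → H1 Ω) : Prop :=
  u ∈ clampedH1 Ω ΓD ∧ ∀ v ∈ clampedH1 Ω ΓD, energy ΓD g α u ≤ energy ΓD g α v

/-- `u` is a clamped field with `(Cu, Cv) + α (∂u, ∂v) = α ∫_Γ g · v ds` for all clamped `v`. -/
def IsWeakSolution {Ω : Set Plane} (ΓD : Set Plane) (g : Fin 2 → BoundaryL2 Ω) (α : ℝ)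
    (u : Fin 2 → H1 Ω) : Prop :=
  u ∈ clampedH1 Ω ΓD ∧ ∀ v ∈ clampedH1 Ω ΓD,
    (∑ i, inner ℝ (cauchyRiemann u i) (cauchyRiemann v i))
      + α * ∑ i, ∑ j, inner ℝ (jacobian u i j) (jacobian v i j) = α * boundaryLoad ΓD g v

end CRLeastSquares

end

noncomputable section

namespace CRLeastSquares

/-! The energy is `½‖Tv‖² - l v`, where `T v = (Bv, √α ∂v)` takes values in a Hilbert space and `l`
is the load. If `T` is bounded below on the clamped fields and `l` is continuous, then Riesz
representation on the closed range of `T` gives exactly one solution of `(Tu, Tv) = l v`, and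
completing the square identifies solutions with minimisers.

Continuity of `l` is a property of the space chosen: a clamped function is stored as a triple of
function, weak derivatives and trace, so the trace is a coordinate. These triples lie in the closure
of the smooth ones. Membership in `clampedH1` already asks for a trace, so neither density of smooth
functions in `H¹` nor surjectivity of any operator is needed. Uniqueness of traces, from the trace
inequality (`exists_trace_bound`), makes the chosen `trace` agree with the stored coordinate.

Boundedness below means that the gradient controls the whole triple. The trace inequality controls
the third entry. The first is controlled by the Friedrichs inequality (`exists_friedrichs_bound`):
near an interior point of `ΓD` one integrates inwards from the boundary, then the bound is carried
through `Ω` along short segments by connectedness, pushed to the boundary by inward shifts, and made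
global by compactness. Both inequalities are proved for smooth functions and pass to the closure by
continuity. -/

/-! ### Estimates along lines. -/

theorem ennreal_add_sq_le (a b : ℝ≥0∞) : (a + b) ^ 2 ≤ 2 * a ^ 2 + 2 * b ^ 2 := by
  rcases eq_or_ne a ⊤ with rfl | ha
  · simp
  rcases eq_or_ne b ⊤ with rfl | hb
  · simp
  lift a to ℝ≥0 using ha
  lift b to ℝ≥0 using hb
  have : (a + b) ^ 2 ≤ 2 * (a ^ 2 + b ^ 2) := add_sq_le
  rw [← mul_add]
  exact_mod_cast this

/-- Cauchy–Schwarz against the constant function 1. -/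
theorem sq_lintegral_le {X : Type*} [MeasurableSpace X] (μ : Measure X) {f : X → ℝ≥0∞}
    (hf : AEMeasurable f μ) : (∫⁻ x, f x ∂μ) ^ 2 ≤ μ univ * ∫⁻ x, f x ^ 2 ∂μ := by
  have h := ENNReal.lintegral_mul_le_Lp_mul_Lq μ (p := 2) (q := 2) ⟨by norm_num, by norm_num, by norm_num⟩
    (aemeasurable_const (b := 1)) hf
  simp only [Pi.mul_apply, one_mul, ENNReal.one_rpow, lintegral_one] at h
  calc (∫⁻ x, f x ∂μ) ^ 2 ≤ (μ univ ^ (1 / 2 : ℝ) * (∫⁻ x, f x ^ (2 : ℝ) ∂μ) ^ (1 / 2 : ℝ)) ^ 2 := by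
        gcongr
    _ = _ := by
        rw [mul_pow]
        simp only [← ENNReal.rpow_natCast, ← ENNReal.rpow_mul]
        norm_num

/-- Fundamental theorem of calculus between `u` and `t`, then Cauchy–Schwarz. Both points are free,
so either one can be fixed and the other averaged over. -/
theorem enorm_sq_le_of_mem_Icc {f : ℝ → ℝ} (hf : ContDiff ℝ 1 f) {a b t u : ℝ}
    (ht : t ∈ Icc a b) (hu : u ∈ Icc a b) :
    ‖f t‖ₑ ^ 2 ≤ 2 * ‖f u‖ₑ ^ 2
      + 2 * (ENNReal.ofReal (b - a) * ∫⁻ s in Ioo a b, ‖deriv f s‖ₑ ^ 2) := by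
  have hc : Continuous (deriv f) := hf.continuous_deriv le_rfl
  have h1 : ∫ s in u..t, deriv f s = f t - f u :=
    intervalIntegral.integral_deriv_eq_sub
      (fun x _ => (hf.differentiable one_ne_zero).differentiableAt) (hc.intervalIntegrable _ _)
  have h2 : ‖f t - f u‖ₑ ≤ ∫⁻ s in Ioo a b, ‖deriv f s‖ₑ := by
    rw [← h1, intervalIntegral.intervalIntegral_eq_integral_uIoc, enorm_smul]
    have : ‖(if u ≤ t then (1 : ℝ) else -1)‖ₑ = 1 := by split_ifs <;> simp
    -- The points `u` and `t` may be endpoints, so the interval between them fits only in the closed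
    -- one; the endpoints are null.
    rw [this, one_mul, setLIntegral_congr Ioo_ae_eq_Icc]
    refine (enorm_integral_le_lintegral_enorm _).trans (lintegral_mono_set ?_)
    exact uIoc_subset_uIcc.trans (uIcc_subset_Icc hu ht)
  have h3 := sq_lintegral_le (volume.restrict (Ioo a b)) (f := fun s => ‖deriv f s‖ₑ)
    hc.enorm.aemeasurable
  rw [Measure.restrict_apply_univ, Real.volume_Ioo] at h3
  calc ‖f t‖ₑ ^ 2 = ‖f u + (f t - f u)‖ₑ ^ 2 := by congr 2; ring
    _ ≤ (‖f u‖ₑ + ‖f t - f u‖ₑ) ^ 2 := by gcongr; exact enorm_add_le _ _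
    _ ≤ 2 * ‖f u‖ₑ ^ 2 + 2 * ‖f t - f u‖ₑ ^ 2 := ennreal_add_sq_le _ _
    _ ≤ _ := by
        gcongr
        exact le_trans (by gcongr) h3

theorem setLIntegral_comp_add_le {A B : Set Plane} {h : Plane}
    (hAB : ∀ z ∈ A, z + h ∈ B) (f : Plane → ℝ≥0∞) :
    ∫⁻ z in A, f (z + h) ≤ ∫⁻ z in B, f z := by
  rw [← (measurePreserving_add_right volume h).setLIntegral_comp_preimage_emb
    (measurableEmbedding_addRight h) f B]
  exact lintegral_mono_set hAB

theorem deriv_comp_line {φ : Plane → ℝ} (hφ : ContDiff ℝ ∞ φ) (z h : Plane) (t : ℝ) :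
    deriv (fun t : ℝ => φ (z + t • h)) t = fderiv ℝ φ (z + t • h) h := by
  have h1 : HasDerivAt (fun t : ℝ => z + t • h) h t := by
    simpa using ((hasDerivAt_id t).smul_const h).const_add z
  exact (((hφ.differentiable (by simp)).differentiableAt).hasFDerivAt.comp_hasDerivAt t h1).deriv

theorem enorm_sq_deriv_comp_line_le {φ : Plane → ℝ} (hφ : ContDiff ℝ ∞ φ) (z h : Plane) (t : ℝ) :
    ‖deriv (fun t : ℝ => φ (z + t • h)) t‖ₑ ^ 2
      ≤ ‖h‖ₑ ^ 2 * ‖fderiv ℝ φ (z + t • h)‖ₑ ^ 2 := by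
  rw [deriv_comp_line hφ, ← mul_pow, mul_comm]
  gcongr
  exact ContinuousLinearMap.le_opENorm _ _

theorem contDiff_comp_line {φ : Plane → ℝ} (hφ : ContDiff ℝ ∞ φ) (z h : Plane) :
    ContDiff ℝ 1 (fun t : ℝ => φ (z + t • h)) :=
  (hφ.of_le (by simp)).comp (by fun_prop)

/-- The line estimate on each segment from `z` to `z + h`, integrated over `z ∈ A`. After Tonelli,
each slice at fixed `t` is a translate of `A` inside `Ω`, so translation invariance bounds it by the
full gradient integral. -/
theorem setLIntegral_sq_le_translate {φ : Plane → ℝ} (hφ : ContDiff ℝ ∞ φ) {A B Ω : Set Plane}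
    {h : Plane} (hB : ∀ z ∈ A, z + h ∈ B)
    (hseg : ∀ z ∈ A, ∀ t ∈ Ioo (0 : ℝ) 1, z + t • h ∈ Ω) :
    ∫⁻ z in A, ‖φ z‖ₑ ^ 2 ≤ 2 * (∫⁻ z in B, ‖φ z‖ₑ ^ 2)
      + 2 * (‖h‖ₑ ^ 2 * ∫⁻ z in Ω, ‖fderiv ℝ φ z‖ₑ ^ 2) := by
  have hd : Continuous (fderiv ℝ φ) := hφ.continuous_fderiv (by simp)
  have hc : Continuous φ := hφ.continuous
  have hm : Measurable (fun p : Plane × ℝ => ‖h‖ₑ ^ 2 * ‖fderiv ℝ φ (p.1 + p.2 • h)‖ₑ ^ 2) := by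
    have : Continuous (fun p : Plane × ℝ => fderiv ℝ φ (p.1 + p.2 • h)) := by fun_prop
    exact (this.enorm.measurable.pow_const _).const_mul _
  calc ∫⁻ z in A, ‖φ z‖ₑ ^ 2
      ≤ ∫⁻ z in A, (2 * ‖φ (z + h)‖ₑ ^ 2
        + 2 * ∫⁻ t in Ioo (0 : ℝ) 1, ‖h‖ₑ ^ 2 * ‖fderiv ℝ φ (z + t • h)‖ₑ ^ 2) := by
        refine lintegral_mono fun z => ?_
        have := enorm_sq_le_of_mem_Icc (contDiff_comp_line hφ z h) (a := 0) (b := 1) (t := 0)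
          (u := 1) (by simp) (by simp)
        simp only [zero_smul, add_zero, one_smul, sub_zero, ENNReal.ofReal_one, one_mul] at this
        refine this.trans ?_
        gcongr
        exact enorm_sq_deriv_comp_line_le hφ z h _
    _ = 2 * (∫⁻ z in A, ‖φ (z + h)‖ₑ ^ 2)
        + 2 * ∫⁻ t in Ioo (0 : ℝ) 1, ∫⁻ z in A, ‖h‖ₑ ^ 2 * ‖fderiv ℝ φ (z + t • h)‖ₑ ^ 2 := by
        have m1 : Measurable fun z => ‖φ (z + h)‖ₑ ^ 2 :=
          ((by fun_prop : Continuous fun z => φ (z + h)).enorm.measurable.pow_const _)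
        rw [lintegral_add_left (m1.const_mul _), lintegral_const_mul _ m1,
          lintegral_const_mul _ hm.lintegral_prod_right', lintegral_lintegral_swap hm.aemeasurable]
    _ ≤ _ := by
        refine add_le_add (mul_le_mul' le_rfl ?_) (mul_le_mul' le_rfl ?_)
        · exact setLIntegral_comp_add_le hB fun z => ‖φ z‖ₑ ^ 2
        · calc ∫⁻ t in Ioo (0 : ℝ) 1, ∫⁻ z in A, ‖h‖ₑ ^ 2 * ‖fderiv ℝ φ (z + t • h)‖ₑ ^ 2
              ≤ ∫⁻ t in Ioo (0 : ℝ) 1, ‖h‖ₑ ^ 2 * ∫⁻ z in Ω, ‖fderiv ℝ φ z‖ₑ ^ 2 := by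
                refine setLIntegral_mono' measurableSet_Ioo fun t ht => ?_
                rw [lintegral_const_mul' _ _ (by simp)]
                exact mul_le_mul' le_rfl (setLIntegral_comp_add_le
                  (fun z hz => hseg z hz t ht) fun z => ‖fderiv ℝ φ z‖ₑ ^ 2)
            _ = _ := by simp

/-! ### Graph coordinates near the boundary. -/

/-- The point over `s`, at height `t` above the graph of `γ`, in the coordinates given by `e`. -/
def graphChart (e : Plane ≃ₗᵢ[ℝ] Plane) (γ : ℝ → ℝ) (p : ℝ × ℝ) : Plane :=
  e.symm !₂[p.1, γ p.1 + p.2]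

/-- The chart is a shear, which translates each vertical fibre, followed by an isometry. Continuity
of `γ` suffices; no Jacobian has to be computed. -/
theorem measurePreserving_graphChart (e : Plane ≃ₗᵢ[ℝ] Plane) {γ : ℝ → ℝ} (hγ : Continuous γ) :
    MeasurePreserving (graphChart e γ) := by
  have h1 : MeasurePreserving (fun p : ℝ × ℝ => (p.1, γ p.1 + p.2)) :=
    (MeasurePreserving.id volume).skew_product (g := fun s t => γ s + t) (by fun_prop)
      (Eventually.of_forall fun s => (measurePreserving_add_left volume (γ s)).map_eq)
  have h2 : MeasurePreserving (fun p : ℝ × ℝ => ![p.1, p.2]) :=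
    (volume_preserving_finTwoArrow ℝ).symm _
  exact e.symm.measurePreserving.comp ((PiLp.volume_preserving_toLp (Fin 2)).comp (h2.comp h1))

theorem graphChart_eq_line (e : Plane ≃ₗᵢ[ℝ] Plane) (γ : ℝ → ℝ) (s t : ℝ) :
    graphChart e γ (s, t) = graphChart e γ (s, 0) + t • e.symm !₂[0, 1] := by
  simp only [graphChart, ← map_smul, ← map_add]
  congr 1
  ext i
  fin_cases i <;> simp

theorem norm_vec_two_zero_one : ‖(!₂[0, 1] : Plane)‖ = 1 := by
  simp [EuclideanSpace.norm_eq]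

theorem norm_vec_two_le (a b : ℝ) : ‖(!₂[a, b] : Plane)‖ ≤ |a| + |b| := by
  rw [EuclideanSpace.norm_eq]
  refine Real.sqrt_le_iff.2 ⟨by positivity, ?_⟩
  simp only [Fin.sum_univ_two, Real.norm_eq_abs]
  simp only [Matrix.cons_val_zero, Matrix.cons_val_one]
  nlinarith [mul_nonneg (abs_nonneg a) (abs_nonneg b)]

theorem apply_graphChart (e : Plane ≃ₗᵢ[ℝ] Plane) (γ : ℝ → ℝ) (s t : ℝ) :
    e (graphChart e γ (s, t)) = !₂[s, γ s + t] := by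
  simp [graphChart]

theorem apply_add_smul_zero (e : Plane ≃ₗᵢ[ℝ] Plane) (x : Plane) (t : ℝ) :
    e (x + t • e.symm !₂[0, 1]) 0 = e x 0 := by
  simp

theorem apply_add_smul_one (e : Plane ≃ₗᵢ[ℝ] Plane) (x : Plane) (t : ℝ) :
    e (x + t • e.symm !₂[0, 1]) 1 = e x 1 + t := by
  simp

theorem eq_graphChart (e : Plane ≃ₗᵢ[ℝ] Plane) {γ : ℝ → ℝ} {x : Plane}
    (hx : γ (e x 0) = e x 1) : x = graphChart e γ (e x 0, 0) := by
  apply e.injective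
  rw [apply_graphChart]
  ext i
  fin_cases i <;> simp [hx]

/-- Strictly below the graph there is a neighbourhood missing `Ω`; a point on the graph is the limit
of points vertically above it, which lie in `Ω`. -/
theorem mem_frontier_iff_of_epigraph {Ω : Set Plane} (hΩ : IsOpen Ω) {z : Plane} {r : ℝ}
    {e : Plane ≃ₗᵢ[ℝ] Plane} {γ : ℝ → ℝ} (hγ : Continuous γ)
    (h : ∀ x ∈ Metric.ball z r, x ∈ Ω ↔ γ (e x 0) < e x 1) {x : Plane}
    (hx : x ∈ Metric.ball z r) : x ∈ frontier Ω ↔ γ (e x 0) = e x 1 := by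
  have c0 : Continuous fun y : Plane => e y 0 := by fun_prop
  have c1 : Continuous fun y : Plane => e y 1 := by fun_prop
  rw [hΩ.frontier_eq, Set.mem_sdiff, h x hx]
  constructor
  · rintro ⟨hc, hn⟩
    refine (not_lt.1 hn).lt_or_eq.elim (fun hlt => ?_) Eq.symm
    obtain ⟨y, ⟨hy1, hy2⟩, hy⟩ := mem_closure_iff.1 hc
      ({y | e y 1 < γ (e y 0)} ∩ Metric.ball z r)
      ((isOpen_lt c1 (hγ.comp c0)).inter Metric.isOpen_ball) ⟨hlt, hx⟩
    exact absurd ((h y hy2).1 hy) (not_lt.2 (le_of_lt hy1))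
  · intro heq
    refine ⟨?_, by rw [heq]; exact lt_irrefl _⟩
    have ht : Tendsto (fun t : ℝ => x + t • e.symm !₂[0, 1]) (𝓝[>] 0) (𝓝 x) := by
      have : Continuous (fun t : ℝ => x + t • e.symm !₂[0, 1]) := by fun_prop
      simpa using (this.tendsto 0).mono_left nhdsWithin_le_nhds
    refine mem_closure_of_tendsto ht ?_
    filter_upwards [ht (Metric.isOpen_ball.mem_nhds hx), self_mem_nhdsWithin] with t h1 h2
    rw [h _ h1, apply_add_smul_zero, apply_add_smul_one, heq]
    exact lt_add_of_pos_right _ h2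

theorem norm_graphChart_sub_le (e : Plane ≃ₗᵢ[ℝ] Plane) {γ : ℝ → ℝ} {K : ℝ≥0}
    (hγ : LipschitzWith K γ) (s s' t t' : ℝ) :
    ‖graphChart e γ (s, t) - graphChart e γ (s', t')‖ ≤ (1 + K) * |s - s'| + |t - t'| := by
  have h := hγ.dist_le_mul s s'
  rw [Real.dist_eq, Real.dist_eq] at h
  have : graphChart e γ (s, t) - graphChart e γ (s', t')
      = e.symm !₂[s - s', (γ s - γ s') + (t - t')] := by
    simp only [graphChart, ← map_sub]
    congr 1
    ext i
    fin_cases i <;> simp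
    ring
  rw [this, e.symm.norm_map]
  refine (norm_vec_two_le _ _).trans ?_
  linarith [abs_add_le (γ s - γ s') (t - t')]

theorem exists_boundary_box {Ω : Set Plane} (hΩ : IsBoundedLipschitzDomain Ω) {z : Plane}
    (hz : z ∈ frontier Ω) {r₀ : ℝ} (hr₀ : 0 < r₀) :
    ∃ (e : Plane ≃ₗᵢ[ℝ] Plane) (γ : ℝ → ℝ) (K : ℝ≥0) (δ : ℝ), LipschitzWith K γ ∧ 0 < δ ∧
      (∀ s ∈ Ioo (e z 0 - δ) (e z 0 + δ), ∀ t ∈ Ioo 0 δ, graphChart e γ (s, t) ∈ Ω) ∧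
      (∀ s ∈ Ioo (e z 0 - δ) (e z 0 + δ), graphChart e γ (s, 0) ∈ Metric.ball z r₀ ∩ frontier Ω) ∧
      ∀ x ∈ Metric.ball z δ ∩ frontier Ω,
        e x 0 ∈ Ioo (e z 0 - δ) (e z 0 + δ) ∧ x = graphChart e γ (e x 0, 0) := by
  obtain ⟨e, γ, K, r, hγ, hr, h⟩ := hΩ.locally_epigraph z hz
  have hfr := @mem_frontier_iff_of_epigraph Ω hΩ.isOpen z r e γ hγ.continuous h
  have hz0 := eq_graphChart e ((hfr (Metric.mem_ball_self hr)).1 hz)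
  -- The chart moves points by at most `(1 + K)|s - s'| + |t - t'|`, which is below `(2 + K)δ` on
  -- the box.
  set δ : ℝ := min r r₀ / (2 + K) with hδ
  have hK : (0 : ℝ) < 2 + K := by positivity
  have hmin : 0 < min r r₀ := lt_min hr hr₀
  have hδ0 : 0 < δ := div_pos hmin hK
  have hδm : (2 + K) * δ = min r r₀ := by rw [hδ]; field_simp
  have hδr : δ ≤ r := by
    refine le_trans ?_ (min_le_left r r₀)
    rw [← hδm]; nlinarith [K.coe_nonneg]
  have key : ∀ s ∈ Ioo (e z 0 - δ) (e z 0 + δ), ∀ t ∈ Ico 0 δ,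
      graphChart e γ (s, t) ∈ Metric.ball z (min r r₀) := by
    intro s hs t ht
    rw [Metric.mem_ball, dist_eq_norm, ← hδm]
    conv_lhs => rw [hz0]
    refine (norm_graphChart_sub_le e hγ _ _ _ _).trans_lt ?_
    have h1 : |s - e z 0| < δ := abs_lt.2 ⟨by linarith [hs.1], by linarith [hs.2]⟩
    have h2 : |t - 0| < δ := by rw [sub_zero, abs_of_nonneg ht.1]; exact ht.2
    nlinarith [K.coe_nonneg]
  refine ⟨e, γ, K, δ, hγ, hδ0, fun s hs t ht => ?_, fun s hs => ?_, fun x hx => ?_⟩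
  · rw [h _ (Metric.ball_subset_ball (min_le_left _ _) (key s hs t ⟨ht.1.le, ht.2⟩)),
      apply_graphChart]
    simpa using ht.1
  · have hb := key s hs 0 ⟨le_rfl, hδ0⟩
    refine ⟨Metric.ball_subset_ball (min_le_right _ _) hb,
      (hfr (Metric.ball_subset_ball (min_le_left _ _) hb)).2 ?_⟩
    rw [apply_graphChart]
    simp
  · refine ⟨?_, eq_graphChart e ((hfr (Metric.ball_subset_ball hδr hx.1)).1 hx.2)⟩
    have h1 : |e x 0 - e z 0| < δ := by
      have h2 : ‖e x - e z‖ < δ := by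
        rw [← map_sub, e.norm_map, ← dist_eq_norm]; exact hx.1
      exact (PiLp.norm_apply_le (e x - e z) 0).trans_lt h2
    rw [abs_lt] at h1
    exact ⟨by linarith [h1.1], by linarith [h1.2]⟩

/-- Moving vertically upwards stays above the graph; shift and radius are both `r / 2`, so nothing
leaves the ball where the chart is valid. -/
theorem exists_inward_shift {Ω : Set Plane} (hΩ : IsBoundedLipschitzDomain Ω) {z : Plane}
    (hz : z ∈ frontier Ω) :
    ∃ (h : Plane) (ρ : ℝ), 0 < ρ ∧ z + h ∈ Ω ∧
      ∀ x ∈ Metric.ball z ρ ∩ Ω, ∀ t ∈ Ioo (0 : ℝ) 1, x + t • h ∈ Ω := by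
  obtain ⟨e, γ, K, r, hγ, hr, h⟩ := hΩ.locally_epigraph z hz
  have hzγ := (mem_frontier_iff_of_epigraph hΩ.isOpen hγ.continuous h
    (Metric.mem_ball_self hr)).1 hz
  have hv : ‖e.symm !₂[(0 : ℝ), 1]‖ = 1 := by rw [e.symm.norm_map, norm_vec_two_zero_one]
  refine ⟨(r / 2) • e.symm !₂[0, 1], r / 2, by positivity, ?_, fun x hx t ht => ?_⟩
  · rw [h, apply_add_smul_zero, apply_add_smul_one, hzγ]
    · linarith
    · rw [Metric.mem_ball, dist_eq_norm, add_sub_cancel_left, norm_smul, hv, Real.norm_eq_abs,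
        abs_of_pos (by positivity)]
      linarith
  · have hxr := hx.1
    rw [Metric.mem_ball, dist_eq_norm] at hxr
    have h1 := (h x (Metric.ball_subset_ball (by linarith) hx.1)).1 hx.2
    rw [smul_smul, h, apply_add_smul_zero, apply_add_smul_one]
    · have := mul_pos ht.1 hr
      linarith
    · rw [Metric.mem_ball, dist_eq_norm, add_sub_right_comm]
      refine (norm_add_le _ _).trans_lt ?_
      rw [norm_smul, hv, Real.norm_eq_abs, abs_of_pos (mul_pos ht.1 (by positivity))]
      nlinarith [ht.2]

theorem graphChart_injective (e : Plane ≃ₗᵢ[ℝ] Plane) (γ : ℝ → ℝ) :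
    Function.Injective (graphChart e γ) := by
  rintro ⟨s, t⟩ ⟨s', t'⟩ h
  have h' := congrArg e h
  rw [apply_graphChart, apply_graphChart] at h'
  have h0 := congrArg (fun v : Plane => v 0) h'
  have h1 := congrArg (fun v : Plane => v 1) h'
  simp only [Matrix.cons_val_zero, Matrix.cons_val_one] at h0 h1
  subst h0
  simpa using h1

theorem continuous_graphChart (e : Plane ≃ₗᵢ[ℝ] Plane) {γ : ℝ → ℝ} (hγ : Continuous γ) :
    Continuous (graphChart e γ) := by
  unfold graphChart
  refine e.symm.continuous.comp ((PiLp.continuous_toLp 2 _).comp ?_)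
  refine continuous_pi fun i => ?_
  fin_cases i
  · exact continuous_fst
  · exact (hγ.comp continuous_fst).add continuous_snd

/-- Fubini's theorem in graph coordinates. -/
theorem lintegral_lintegral_graphChart_le (e : Plane ≃ₗᵢ[ℝ] Plane) {γ : ℝ → ℝ} (hγ : Continuous γ)
    {I J : Set ℝ} {A : Set Plane} (hA : ∀ s ∈ I, ∀ t ∈ J, graphChart e γ (s, t) ∈ A)
    {f : Plane → ℝ≥0∞} (hf : Measurable f) :
    ∫⁻ s in I, ∫⁻ t in J, f (graphChart e γ (s, t)) ≤ ∫⁻ x in A, f x := by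
  have hc := continuous_graphChart e hγ
  rw [← lintegral_prod (μ := volume.restrict I) (ν := volume.restrict J)
      (fun p => f (graphChart e γ p)) (hf.comp hc.measurable).aemeasurable,
    Measure.prod_restrict, ← Measure.volume_eq_prod]
  rw [← (measurePreserving_graphChart e hγ).setLIntegral_comp_preimage_emb
    (hc.measurableEmbedding (graphChart_injective e γ)) f A]
  exact lintegral_mono_set fun p hp => hA p.1 hp.1 p.2 hp.2

theorem lintegral_image_graphChart_eq (e : Plane ≃ₗᵢ[ℝ] Plane) {γ : ℝ → ℝ} (hγ : Continuous γ)
    (I J : Set ℝ) {f : Plane → ℝ≥0∞} (hf : Measurable f) :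
    ∫⁻ x in graphChart e γ '' (I ×ˢ J), f x
      = ∫⁻ s in I, ∫⁻ t in J, f (graphChart e γ (s, t)) := by
  have hc := continuous_graphChart e hγ
  rw [← lintegral_prod (μ := volume.restrict I) (ν := volume.restrict J)
      (fun p => f (graphChart e γ p)) (hf.comp hc.measurable).aemeasurable,
    Measure.prod_restrict, ← Measure.volume_eq_prod,
    ← (measurePreserving_graphChart e hγ).setLIntegral_comp_preimage_emb
    (hc.measurableEmbedding (graphChart_injective e γ)) f,
    preimage_image_eq _ (graphChart_injective e γ)]

theorem enorm_sq_graphChart_le {φ : Plane → ℝ} (hφ : ContDiff ℝ ∞ φ) (e : Plane ≃ₗᵢ[ℝ] Plane)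
    (γ : ℝ → ℝ) {δ t u : ℝ} (s : ℝ) (ht : t ∈ Icc 0 δ) (hu : u ∈ Icc 0 δ) :
    ‖φ (graphChart e γ (s, t))‖ₑ ^ 2 ≤ 2 * ‖φ (graphChart e γ (s, u))‖ₑ ^ 2
      + 2 * (ENNReal.ofReal δ *
        ∫⁻ τ in Ioo 0 δ, ‖fderiv ℝ φ (graphChart e γ (s, τ))‖ₑ ^ 2) := by
  have h := enorm_sq_le_of_mem_Icc
    (contDiff_comp_line hφ (graphChart e γ (s, 0)) (e.symm !₂[0, 1])) ht hu
  simp only [← graphChart_eq_line, sub_zero] at h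
  refine h.trans (add_le_add le_rfl (mul_le_mul' le_rfl (mul_le_mul' le_rfl
    (lintegral_mono fun τ => ?_))))
  have h' := enorm_sq_deriv_comp_line_le hφ (graphChart e γ (s, 0)) (e.symm !₂[0, 1]) τ
  simp only [← graphChart_eq_line] at h'
  refine h'.trans_eq ?_
  rw [← ofReal_norm (e.symm _), e.symm.norm_map, norm_vec_two_zero_one,
    ENNReal.ofReal_one, one_pow, one_mul]

/-! ### From local to global bounds, and arc length in graph coordinates. -/

/-- Such a bound passes to subsets and to unions of two sets, so compact induction applies. The
index `i` runs over test functions and keeps the constant uniform in them. -/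
theorem exists_setLIntegral_le_of_isCompact {ι : Type*} (μ : Measure Plane)
    (F : ι → Plane → ℝ≥0∞) (R : ι → ℝ≥0∞) {S : Set Plane} (hS : IsCompact S)
    (h : ∀ z ∈ S, ∃ ρ > 0, ∃ C : ℝ≥0∞, C ≠ ⊤ ∧
      ∀ i, ∫⁻ x in Metric.ball z ρ, F i x ∂μ ≤ C * R i) :
    ∃ C : ℝ≥0∞, C ≠ ⊤ ∧ ∀ i, ∫⁻ x in S, F i x ∂μ ≤ C * R i := by
  refine hS.induction_on (p := fun s => ∃ C : ℝ≥0∞, C ≠ ⊤ ∧ ∀ i, ∫⁻ x in s, F i x ∂μ ≤ C * R i)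
    ⟨0, by simp, by simp⟩ ?_ ?_ ?_
  · rintro s t hst ⟨C, hC, hb⟩
    exact ⟨C, hC, fun i => (lintegral_mono_set hst).trans (hb i)⟩
  · rintro s t ⟨C, hC, hb⟩ ⟨C', hC', hb'⟩
    refine ⟨C + C', ENNReal.add_ne_top.2 ⟨hC, hC'⟩, fun i => ?_⟩
    rw [add_mul]
    exact (lintegral_union_le _ _ _).trans (add_le_add (hb i) (hb' i))
  · intro z hz
    obtain ⟨ρ, hρ, C, hC, hb⟩ := h z hz
    exact ⟨_, mem_nhdsWithin_of_mem_nhds (Metric.ball_mem_nhds z hρ), C, hC, hb⟩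

theorem lipschitzWith_graphChart_zero (e : Plane ≃ₗᵢ[ℝ] Plane) {γ : ℝ → ℝ} {K : ℝ≥0}
    (hγ : LipschitzWith K γ) : LipschitzWith (1 + K) fun s => graphChart e γ (s, 0) := by
  refine LipschitzWith.of_dist_le_mul fun s s' => ?_
  rw [dist_eq_norm, Real.dist_eq]
  simpa using norm_graphChart_sub_le e hγ s s' 0 0

/-- The parametrisation of the graph is `(1 + K)`-Lipschitz, and one-dimensional Hausdorff measure
on `ℝ` is Lebesgue measure. -/
theorem setLIntegral_hausdorff_graph_le (e : Plane ≃ₗᵢ[ℝ] Plane) {γ : ℝ → ℝ} {K : ℝ≥0}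
    (hγ : LipschitzWith K γ) {I : Set ℝ} {B : Set Plane}
    (hB : ∀ x ∈ B, e x 0 ∈ I ∧ x = graphChart e γ (e x 0, 0)) {f : Plane → ℝ≥0∞}
    (hf : Measurable f) :
    ∫⁻ x in B, f x ∂(Measure.hausdorffMeasure 1)
      ≤ (1 + K : ℝ≥0) * ∫⁻ s in I, f (graphChart e γ (s, 0)) := by
  have hl := lipschitzWith_graphChart_zero e hγ
  have hm : (Measure.hausdorffMeasure 1 : Measure Plane).restrict B
      ≤ ((1 + K : ℝ≥0) : ℝ≥0∞) • (volume.restrict I).map fun s => graphChart e γ (s, 0) := by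
    refine Measure.le_iff.2 fun E hE => ?_
    rw [Measure.restrict_apply hE, Measure.smul_apply, Measure.map_apply hl.continuous.measurable hE,
      Measure.restrict_apply (hl.continuous.measurable hE), smul_eq_mul, ← hausdorffMeasure_real]
    have h1 := hl.hausdorffMeasure_image_le zero_le_one
      ((fun s => graphChart e γ (s, 0)) ⁻¹' E ∩ I)
    rw [ENNReal.rpow_one] at h1
    refine (measure_mono ?_).trans h1
    rintro x ⟨hxE, hxB⟩
    obtain ⟨hI, hx⟩ := hB x hxB
    exact ⟨e x 0, ⟨by rw [mem_preimage, ← hx]; exact hxE, hI⟩, hx.symm⟩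
  refine (lintegral_mono' hm le_rfl).trans_eq ?_
  rw [lintegral_smul_measure, lintegral_map hf hl.continuous.measurable, smul_eq_mul]

/-- Here the inverse of the parametrisation is used: the coordinate `e x 0` is 1-Lipschitz. -/
theorem setLIntegral_graph_le_hausdorff (e : Plane ≃ₗᵢ[ℝ] Plane) {γ : ℝ → ℝ} {K : ℝ≥0}
    (hγ : LipschitzWith K γ) {I : Set ℝ} {B : Set Plane}
    (hB : ∀ s ∈ I, graphChart e γ (s, 0) ∈ B) {f : Plane → ℝ≥0∞} (hf : Measurable f) :
    ∫⁻ s in I, f (graphChart e γ (s, 0)) ≤ ∫⁻ x in B, f x ∂(Measure.hausdorffMeasure 1) := by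
  have hl := lipschitzWith_graphChart_zero e hγ
  have hπ : LipschitzWith 1 fun x : Plane => e x 0 := by
    refine LipschitzWith.of_dist_le_mul fun x y => ?_
    rw [NNReal.coe_one, one_mul, ← e.dist_map, dist_eq_norm, dist_eq_norm]
    exact PiLp.norm_apply_le (e x - e y) 0
  have hm : (volume.restrict I).map (fun s => graphChart e γ (s, 0))
      ≤ (Measure.hausdorffMeasure 1 : Measure Plane).restrict B := by
    refine Measure.le_iff.2 fun E hE => ?_
    rw [Measure.restrict_apply hE, Measure.map_apply hl.continuous.measurable hE,
      Measure.restrict_apply (hl.continuous.measurable hE), ← hausdorffMeasure_real]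
    have h1 := hπ.hausdorffMeasure_image_le zero_le_one (E ∩ B)
    rw [ENNReal.rpow_one, ENNReal.coe_one, one_mul] at h1
    refine (measure_mono ?_).trans h1
    rintro s ⟨hsE, hsI⟩
    exact ⟨graphChart e γ (s, 0), ⟨hsE, hB s hsI⟩, by simp [apply_graphChart]⟩
  rw [← lintegral_map hf hl.continuous.measurable]
  exact lintegral_mono' hm le_rfl

/-! ### The trace inequality for smooth functions. -/

theorem measurable_enorm_sq {φ : Plane → ℝ} (hφ : ContDiff ℝ ∞ φ) :
    Measurable fun x => ‖φ x‖ₑ ^ 2 :=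
  hφ.continuous.enorm.measurable.pow_const _

theorem measurable_enorm_sq_fderiv {φ : Plane → ℝ} (hφ : ContDiff ℝ ∞ φ) :
    Measurable fun x => ‖fderiv ℝ φ x‖ₑ ^ 2 :=
  (hφ.continuous_fderiv (by simp)).enorm.measurable.pow_const _

/-- The trace inequality in graph coordinates. -/
theorem setLIntegral_graph_sq_le {φ : Plane → ℝ} (hφ : ContDiff ℝ ∞ φ) (e : Plane ≃ₗᵢ[ℝ] Plane)
    {γ : ℝ → ℝ} (hγ : Continuous γ) {I : Set ℝ} {δ : ℝ} (hδ : 0 < δ) {Ω : Set Plane}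
    (hΩ : ∀ s ∈ I, ∀ t ∈ Ioo 0 δ, graphChart e γ (s, t) ∈ Ω) :
    ENNReal.ofReal δ * ∫⁻ s in I, ‖φ (graphChart e γ (s, 0))‖ₑ ^ 2
      ≤ 2 * (∫⁻ x in Ω, ‖φ x‖ₑ ^ 2)
        + ENNReal.ofReal δ * (2 * ENNReal.ofReal δ) * ∫⁻ x in Ω, ‖fderiv ℝ φ x‖ₑ ^ 2 := by
  have hc := continuous_graphChart e hγ
  have m1 := measurable_enorm_sq hφ
  have m2 := measurable_enorm_sq_fderiv hφ
  have m1' : Measurable fun s => ∫⁻ t in Ioo 0 δ, ‖φ (graphChart e γ (s, t))‖ₑ ^ 2 :=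
    (m1.comp hc.measurable).lintegral_prod_right'
  have hs : ∀ s, ENNReal.ofReal δ * ‖φ (graphChart e γ (s, 0))‖ₑ ^ 2
      ≤ 2 * (∫⁻ t in Ioo 0 δ, ‖φ (graphChart e γ (s, t))‖ₑ ^ 2)
        + ENNReal.ofReal δ * (2 * ENNReal.ofReal δ) *
          ∫⁻ t in Ioo 0 δ, ‖fderiv ℝ φ (graphChart e γ (s, t))‖ₑ ^ 2 := by
    intro s
    have hmt : Measurable fun t => ‖φ (graphChart e γ (s, t))‖ₑ ^ 2 :=
      m1.comp (hc.measurable.comp measurable_prodMk_left)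
    calc ENNReal.ofReal δ * ‖φ (graphChart e γ (s, 0))‖ₑ ^ 2
        -- The boundary value is averaged over heights `t ∈ (0, δ)`, comparing it with the value at
        -- each height.
        = ∫⁻ _ in Ioo 0 δ, ‖φ (graphChart e γ (s, 0))‖ₑ ^ 2 := by simp [mul_comm]
      _ ≤ ∫⁻ t in Ioo 0 δ, (2 * ‖φ (graphChart e γ (s, t))‖ₑ ^ 2 + 2 * (ENNReal.ofReal δ *
            ∫⁻ τ in Ioo 0 δ, ‖fderiv ℝ φ (graphChart e γ (s, τ))‖ₑ ^ 2)) :=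
          setLIntegral_mono' measurableSet_Ioo fun t ht =>
            enorm_sq_graphChart_le hφ e γ s ⟨le_rfl, hδ.le⟩ ⟨ht.1.le, ht.2.le⟩
      _ = _ := by
          rw [lintegral_add_left (hmt.const_mul _), lintegral_const_mul _ hmt, lintegral_const,
            Measure.restrict_apply_univ, Real.volume_Ioo, sub_zero]
          ring
  rw [← lintegral_const_mul' _ _ ENNReal.ofReal_ne_top]
  refine (lintegral_mono hs).trans ?_
  rw [lintegral_add_left (m1'.const_mul _), lintegral_const_mul _ m1',
    lintegral_const_mul' _ _ (ENNReal.mul_ne_top (by simp) (ENNReal.mul_ne_top (by simp) (by simp)))]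
  exact add_le_add (mul_le_mul' le_rfl (lintegral_lintegral_graphChart_le e hγ hΩ m1))
    (mul_le_mul' le_rfl (lintegral_lintegral_graphChart_le e hγ hΩ m2))

/-- The Friedrichs inequality in graph coordinates. -/
theorem setLIntegral_image_graphChart_sq_le {φ : Plane → ℝ} (hφ : ContDiff ℝ ∞ φ)
    (e : Plane ≃ₗᵢ[ℝ] Plane) {γ : ℝ → ℝ} (hγ : Continuous γ) {I : Set ℝ} {δ : ℝ} (hδ : 0 < δ)
    {Ω : Set Plane} (hΩ : ∀ s ∈ I, ∀ t ∈ Ioo 0 δ, graphChart e γ (s, t) ∈ Ω) :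
    ∫⁻ x in graphChart e γ '' (I ×ˢ Ioo 0 δ), ‖φ x‖ₑ ^ 2
      ≤ ENNReal.ofReal δ * 2 * (∫⁻ s in I, ‖φ (graphChart e γ (s, 0))‖ₑ ^ 2)
        + ENNReal.ofReal δ * (2 * ENNReal.ofReal δ) * ∫⁻ x in Ω, ‖fderiv ℝ φ x‖ₑ ^ 2 := by
  have hc := continuous_graphChart e hγ
  have m1 := measurable_enorm_sq hφ
  have m2 := measurable_enorm_sq_fderiv hφ
  have m0 : Measurable fun s => ‖φ (graphChart e γ (s, 0))‖ₑ ^ 2 :=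
    m1.comp (hc.measurable.comp measurable_prodMk_right)
  have hs : ∀ s, ∫⁻ t in Ioo 0 δ, ‖φ (graphChart e γ (s, t))‖ₑ ^ 2
      ≤ ENNReal.ofReal δ * 2 * ‖φ (graphChart e γ (s, 0))‖ₑ ^ 2
        + ENNReal.ofReal δ * (2 * ENNReal.ofReal δ) *
          ∫⁻ t in Ioo 0 δ, ‖fderiv ℝ φ (graphChart e γ (s, t))‖ₑ ^ 2 := by
    intro s
    calc ∫⁻ t in Ioo 0 δ, ‖φ (graphChart e γ (s, t))‖ₑ ^ 2
        ≤ ∫⁻ _ in Ioo 0 δ, (2 * ‖φ (graphChart e γ (s, 0))‖ₑ ^ 2 + 2 * (ENNReal.ofReal δ *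
            ∫⁻ τ in Ioo 0 δ, ‖fderiv ℝ φ (graphChart e γ (s, τ))‖ₑ ^ 2)) :=
          setLIntegral_mono' measurableSet_Ioo fun t ht =>
            enorm_sq_graphChart_le hφ e γ s ⟨ht.1.le, ht.2.le⟩ ⟨le_rfl, hδ.le⟩
      _ = _ := by
          rw [lintegral_const, Measure.restrict_apply_univ, Real.volume_Ioo, sub_zero]
          ring
  rw [lintegral_image_graphChart_eq e hγ I _ m1]
  refine (lintegral_mono hs).trans ?_
  rw [lintegral_add_left (m0.const_mul _), lintegral_const_mul _ m0,
    lintegral_const_mul' _ _ (ENNReal.mul_ne_top (by simp) (ENNReal.mul_ne_top (by simp) (by simp)))]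
  exact add_le_add le_rfl
    (mul_le_mul' le_rfl (lintegral_lintegral_graphChart_le e hγ hΩ m2))

theorem exists_local_trace_bound {Ω : Set Plane} (hΩ : IsBoundedLipschitzDomain Ω) {z : Plane}
    (hz : z ∈ frontier Ω) :
    ∃ ρ > 0, ∃ C : ℝ≥0∞, C ≠ ⊤ ∧ ∀ φ : {φ : Plane → ℝ // ContDiff ℝ ∞ φ},
      ∫⁻ x in Metric.ball z ρ, ‖φ.1 x‖ₑ ^ 2 ∂(surfaceMeasure Ω)
        ≤ C * ((∫⁻ x in Ω, ‖φ.1 x‖ₑ ^ 2) + ∫⁻ x in Ω, ‖fderiv ℝ φ.1 x‖ₑ ^ 2) := by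
  obtain ⟨e, γ, K, δ, hγ, hδ, h1, h2, h3⟩ := exists_boundary_box hΩ hz one_pos
  set d := ENNReal.ofReal δ with hd
  have hd0 : d ≠ 0 := by simpa [hd] using hδ
  have hdt : d ≠ ⊤ := ENNReal.ofReal_ne_top
  refine ⟨δ, hδ, (1 + K : ℝ≥0) * (d⁻¹ * (2 + d * (2 * d))), ?_, fun ⟨φ, hφ⟩ => ?_⟩
  · finiteness
  · rw [Measure.restrict_restrict Metric.isOpen_ball.measurableSet]
    refine (setLIntegral_hausdorff_graph_le e hγ h3 (measurable_enorm_sq hφ)).trans ?_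
    have h4 := setLIntegral_graph_sq_le hφ e hγ.continuous hδ h1
    rw [← hd] at h4
    rw [mul_assoc]
    refine mul_le_mul' le_rfl ?_
    rw [mul_assoc]
    refine (ENNReal.mul_le_iff_le_inv hd0 hdt).1 (h4.trans ?_)
    rw [add_mul]
    exact add_le_add (mul_le_mul' le_rfl le_self_add) (mul_le_mul' le_rfl le_add_self)

/-- The trace inequality for functions that are smooth up to the boundary. -/
theorem exists_trace_bound {Ω : Set Plane} (hΩ : IsBoundedLipschitzDomain Ω) :
    ∃ C : ℝ≥0∞, C ≠ ⊤ ∧ ∀ φ : {φ : Plane → ℝ // ContDiff ℝ ∞ φ},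
      ∫⁻ x, ‖φ.1 x‖ₑ ^ 2 ∂(surfaceMeasure Ω)
        ≤ C * ((∫⁻ x in Ω, ‖φ.1 x‖ₑ ^ 2) + ∫⁻ x in Ω, ‖fderiv ℝ φ.1 x‖ₑ ^ 2) := by
  have hcomp : IsCompact (frontier Ω) :=
    hΩ.isBounded.isCompact_closure.of_isClosed_subset isClosed_frontier frontier_subset_closure
  have h := exists_setLIntegral_le_of_isCompact (surfaceMeasure Ω)
    (fun (φ : {φ : Plane → ℝ // ContDiff ℝ ∞ φ}) x => ‖φ.1 x‖ₑ ^ 2)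
    (fun φ => (∫⁻ x in Ω, ‖φ.1 x‖ₑ ^ 2) + ∫⁻ x in Ω, ‖fderiv ℝ φ.1 x‖ₑ ^ 2) hcomp
    fun z hz => exists_local_trace_bound hΩ hz
  rwa [Measure.restrict_restrict isClosed_frontier.measurableSet, inter_self] at h

/-- The trace inequality for the constant function 1 bounds the boundary length by a multiple of the
area of `Ω`. -/
theorem isFiniteMeasure_surfaceMeasure {Ω : Set Plane} (hΩ : IsBoundedLipschitzDomain Ω) :
    IsFiniteMeasure (surfaceMeasure Ω) := by
  obtain ⟨C, hC, h⟩ := exists_trace_bound hΩ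
  have h1 := h ⟨fun _ => 1, contDiff_const⟩
  have hv : volume Ω < ⊤ := hΩ.isBounded.measure_lt_top
  have h0 : ‖(0 : Plane →L[ℝ] ℝ)‖ₑ = 0 := by rw [← ofReal_norm, norm_zero, ENNReal.ofReal_zero]
  exact ⟨lt_of_le_of_lt (by simpa [h0] using h1) (ENNReal.mul_lt_top hC.lt_top hv)⟩

/-! ### The Friedrichs inequality for smooth functions. -/

/-- The `L²` norms near `z` of smooth functions are bounded by their `L²` norms on `Γ_D` and the
`L²` norms of their gradients. -/
def IsFriedrichsPoint (Ω ΓD : Set Plane) (z : Plane) : Prop :=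
  ∃ ρ > 0, ∃ C : ℝ≥0∞, C ≠ ⊤ ∧ ∀ φ : {φ : Plane → ℝ // ContDiff ℝ ∞ φ},
    ∫⁻ x in Metric.ball z ρ, ‖φ.1 x‖ₑ ^ 2 ∂(volume.restrict Ω)
      ≤ C * ((∫⁻ x in ΓD, ‖φ.1 x‖ₑ ^ 2 ∂(Measure.hausdorffMeasure 1))
        + ∫⁻ x in Ω, ‖fderiv ℝ φ.1 x‖ₑ ^ 2)

theorem isOpen_setOf_isFriedrichsPoint (Ω ΓD : Set Plane) :
    IsOpen {z | IsFriedrichsPoint Ω ΓD z} := by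
  refine Metric.isOpen_iff.2 fun z ⟨ρ, hρ, C, hC, h⟩ => ⟨ρ / 2, by positivity, fun y hy =>
    ⟨ρ / 2, by positivity, C, hC, fun φ => (lintegral_mono_set ?_).trans (h φ)⟩⟩
  refine Metric.ball_subset_ball' ?_
  rw [Metric.mem_ball] at hy
  linarith

/-- A small ball around `z`, cut with `Ω`, is translated by `h` into the ball where the bound is
known; the error is a gradient integral along segments inside `Ω`. -/
theorem IsFriedrichsPoint.of_shift {Ω ΓD : Set Plane} (hΩ : IsOpen Ω) {z h : Plane} {ρ : ℝ}
    (hρ : 0 < ρ) (hzh : z + h ∈ Ω) (hF : IsFriedrichsPoint Ω ΓD (z + h))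
    (hseg : ∀ x ∈ Metric.ball z ρ ∩ Ω, ∀ t ∈ Ioo (0 : ℝ) 1, x + t • h ∈ Ω) :
    IsFriedrichsPoint Ω ΓD z := by
  obtain ⟨ε, hε, C, hC, hb⟩ := hF
  obtain ⟨η, hη, hball⟩ := Metric.isOpen_iff.1 hΩ _ hzh
  refine ⟨min ρ (min ε η), by positivity, 2 * C + 2 * ‖h‖ₑ ^ 2, by finiteness, fun φ => ?_⟩
  rw [Measure.restrict_restrict Metric.isOpen_ball.measurableSet]
  refine (setLIntegral_sq_le_translate φ.2 (B := Metric.ball (z + h) ε ∩ Ω) (Ω := Ω) (h := h)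
    ?_ ?_).trans ?_
  · rintro x ⟨hx, -⟩
    rw [Metric.mem_ball, lt_min_iff, lt_min_iff] at hx
    have hd : dist (x + h) (z + h) = dist x z := dist_add_right _ _ _
    exact ⟨by rw [Metric.mem_ball, hd]; exact hx.2.1,
      hball (by rw [Metric.mem_ball, hd]; exact hx.2.2)⟩
  · rintro x ⟨hx, hxΩ⟩
    exact hseg x ⟨Metric.ball_subset_ball (min_le_left _ _) hx, hxΩ⟩
  · have hb' := hb φ
    rw [Measure.restrict_restrict Metric.isOpen_ball.measurableSet] at hb'
    rw [add_mul, mul_assoc, mul_assoc]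
    exact add_le_add (mul_le_mul' le_rfl hb')
      (mul_le_mul' le_rfl (mul_le_mul' le_rfl le_add_self))

/-- Over a boundary patch contained in `ΓD`, the function in the strip of height `δ` is controlled
by its values on the patch and its gradient. A point at mid-height has a ball inside this strip. -/
theorem exists_isFriedrichsPoint {Ω ΓD : Set Plane} (hΩ : IsBoundedLipschitzDomain Ω)
    (hsub : ΓD ⊆ frontier Ω)
    (hint : ∃ z ∈ ΓD, ∃ r : ℝ, 0 < r ∧ Metric.ball z r ∩ frontier Ω ⊆ ΓD) :
    ∃ z ∈ Ω, IsFriedrichsPoint Ω ΓD z := by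
  obtain ⟨z, hz, r, hr, hball⟩ := hint
  obtain ⟨e, γ, K, δ, hγ, hδ, h1, h2, -⟩ := exists_boundary_box hΩ (hsub hz) hr
  set I := Ioo (e z 0 - δ) (e z 0 + δ) with hI
  set d := ENNReal.ofReal δ with hd
  have hdt : d ≠ ⊤ := ENNReal.ofReal_ne_top
  have hz0 : e z 0 ∈ I := ⟨by linarith, by linarith⟩
  have hδ2 : δ / 2 ∈ Ioo 0 δ := ⟨by linarith, by linarith⟩
  have hopen : IsOpen {x : Plane | e x 0 ∈ I ∧ e x 1 - γ (e x 0) ∈ Ioo 0 δ} := by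
    have c0 : Continuous fun y : Plane => e y 0 := by fun_prop
    have c1 : Continuous fun y : Plane => e y 1 := by fun_prop
    exact (isOpen_Ioo.preimage c0).inter
      (isOpen_Ioo.preimage (c1.sub (hγ.continuous.comp c0)))
  obtain ⟨ρ, hρ, hsubρ⟩ := Metric.isOpen_iff.1 hopen (graphChart e γ (e z 0, δ / 2)) (by
    rw [Set.mem_ofPred_eq, apply_graphChart]
    simpa using ⟨hz0, hδ⟩)
  have himg : Metric.ball (graphChart e γ (e z 0, δ / 2)) ρ
      ⊆ graphChart e γ '' (I ×ˢ Ioo 0 δ) := by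
    intro x hx
    obtain ⟨hx0, hx1⟩ := hsubρ hx
    refine ⟨(e x 0, e x 1 - γ (e x 0)), ⟨hx0, hx1⟩, e.injective ?_⟩
    rw [apply_graphChart]
    ext i
    fin_cases i <;> simp
  refine ⟨_, h1 _ hz0 _ hδ2, ρ, hρ, d * 2 + d * (2 * d), by finiteness, fun ⟨φ, hφ⟩ => ?_⟩
  refine (lintegral_mono' (Measure.restrict_mono himg Measure.restrict_le_self) le_rfl).trans ?_
  refine (setLIntegral_image_graphChart_sq_le hφ e hγ.continuous hδ h1).trans ?_
  rw [add_mul]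
  refine add_le_add (mul_le_mul' le_rfl (le_trans ?_ le_self_add))
    (mul_le_mul' le_rfl le_add_self)
  exact setLIntegral_graph_le_hausdorff e hγ (fun s hs => hball (h2 s hs))
    (measurable_enorm_sq hφ)

/-- The Friedrichs inequality for functions that are smooth up to the boundary. -/
theorem exists_friedrichs_bound {Ω ΓD : Set Plane} (hΩ : IsBoundedLipschitzDomain Ω)
    (hsub : ΓD ⊆ frontier Ω)
    (hint : ∃ z ∈ ΓD, ∃ r : ℝ, 0 < r ∧ Metric.ball z r ∩ frontier Ω ⊆ ΓD) :
    ∃ C : ℝ≥0∞, C ≠ ⊤ ∧ ∀ φ : {φ : Plane → ℝ // ContDiff ℝ ∞ φ},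
      ∫⁻ x in Ω, ‖φ.1 x‖ₑ ^ 2
        ≤ C * ((∫⁻ x in ΓD, ‖φ.1 x‖ₑ ^ 2 ∂(Measure.hausdorffMeasure 1))
          + ∫⁻ x in Ω, ‖fderiv ℝ φ.1 x‖ₑ ^ 2) := by
  have hin : Ω ⊆ {z | IsFriedrichsPoint Ω ΓD z} := by
    refine hΩ.isConnected.isPreconnected.subset_of_closure_inter_subset
      (isOpen_setOf_isFriedrichsPoint Ω ΓD) (exists_isFriedrichsPoint hΩ hsub hint) ?_
    -- Relative closedness in `Ω`: a limit point `x` has a Friedrichs point `y` within `R / 2`, and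
    -- shifting the ball of radius `R / 2` towards `y` stays in the ball of radius `R` inside `Ω`.
    rintro x ⟨hxc, hx⟩
    obtain ⟨R, hR, hball⟩ := Metric.isOpen_iff.1 hΩ.isOpen x hx
    obtain ⟨y, hy, hxy⟩ := Metric.mem_closure_iff.1 hxc (R / 2) (by positivity)
    rw [dist_comm] at hxy
    have hyx : x + (y - x) = y := by abel
    refine IsFriedrichsPoint.of_shift hΩ.isOpen (h := y - x) (ρ := R / 2) (by positivity)
      (by rw [hyx]; exact hball (by rw [Metric.mem_ball]; linarith)) (by rwa [hyx]) ?_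
    rintro w ⟨hw, -⟩ t ht
    apply hball
    rw [Metric.mem_ball, dist_eq_norm] at hw ⊢
    rw [dist_eq_norm] at hxy
    rw [add_sub_right_comm]
    refine (norm_add_le _ _).trans_lt ?_
    rw [norm_smul, Real.norm_eq_abs, abs_of_pos ht.1]
    nlinarith [ht.2, norm_nonneg (y - x)]
  have hall : ∀ z ∈ closure Ω, IsFriedrichsPoint Ω ΓD z := by
    intro z hz
    rw [closure_eq_self_union_frontier] at hz
    rcases hz with hz | hz
    · exact hin hz
    · obtain ⟨h, ρ, hρ, hzh, hseg⟩ := exists_inward_shift hΩ hz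
      exact IsFriedrichsPoint.of_shift hΩ.isOpen hρ hzh (hin hzh) hseg
  have h := exists_setLIntegral_le_of_isCompact (volume.restrict Ω)
    (fun (φ : {φ : Plane → ℝ // ContDiff ℝ ∞ φ}) x => ‖φ.1 x‖ₑ ^ 2)
    (fun φ => (∫⁻ x in ΓD, ‖φ.1 x‖ₑ ^ 2 ∂(Measure.hausdorffMeasure 1))
      + ∫⁻ x in Ω, ‖fderiv ℝ φ.1 x‖ₑ ^ 2) hΩ.isBounded.isCompact_closure hall
  rwa [Measure.restrict_restrict isClosed_closure.measurableSet,
    inter_eq_right.2 subset_closure] at h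

/-! ### Abstract quadratic minimisation. -/

section Riesz

variable {E K : Type*} [NormedAddCommGroup E] [NormedSpace ℝ E]
  [NormedAddCommGroup K] [InnerProductSpace ℝ K]

/-- Being bounded below makes `T` an isomorphism onto its closed, hence complete, range; `l` is
transported there and represented by Riesz. The space `E` carries only a norm, so it may be a
product with the sup norm. -/
theorem exists_forall_inner_apply_eq [CompleteSpace E] [CompleteSpace K] (T : E →L[ℝ] K)
    {c : ℝ≥0} (hT : ∀ v, ‖v‖ ≤ c * ‖T v‖) (l : E →L[ℝ] ℝ) :
    ∃ u, ∀ v, inner ℝ (T u) (T v) = l v := by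
  have hanti : AntilipschitzWith c T := T.antilipschitz_of_bound hT
  have hclo : IsClosed (range T) := (hanti.isComplete_range T.uniformContinuous).isClosed
  have hcs : CompleteSpace T.range := completeSpace_coe_iff_isComplete.2
    (hanti.isComplete_range T.uniformContinuous)
  let e := T.equivRange hanti.injective hclo
  obtain ⟨u, hu⟩ := e.surjective ((InnerProductSpace.toDual ℝ T.range).symm
    (l.comp (e.symm : T.range →L[ℝ] E)))
  refine ⟨u, fun v => ?_⟩
  have h1 : inner ℝ (e u) (e v) = l v := by
    rw [hu, InnerProductSpace.toDual_symm_apply]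
    simp
  rw [Submodule.coe_inner] at h1
  have he : ∀ v, ((e v : T.range) : K) = T v := fun v =>
    congrArg Subtype.val (congrFun (T.coe_equivRange hanti.injective hclo) v)
  rwa [he, he] at h1

theorem half_norm_sq_sub_le_iff (T : E →L[ℝ] K) (l : E →L[ℝ] ℝ) (u : E) :
    (∀ v, 1 / 2 * ‖T u‖ ^ 2 - l u ≤ 1 / 2 * ‖T v‖ ^ 2 - l v)
      ↔ ∀ v, inner ℝ (T u) (T v) = l v := by
  have key : ∀ v, 1 / 2 * ‖T (u + v)‖ ^ 2 - l (u + v)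
      = (1 / 2 * ‖T u‖ ^ 2 - l u) + (inner ℝ (T u) (T v) - l v) + 1 / 2 * ‖T v‖ ^ 2 := by
    intro v
    rw [map_add, map_add, norm_add_sq_real]
    ring
  constructor
  · intro h v
    set a := inner ℝ (T u) (T v) - l v with ha
    set b := ‖T v‖ ^ 2 with hb
    have hb0 : 0 ≤ b := by positivity
    -- The increment along `t • v` is `t a + t² b / 2`. The exact minimiser `-a / b` fails when `T v
    -- = 0`; `b + 1` avoids this and still makes the increment negative unless `a = 0`.
    have h1 := h (u + (-(a / (b + 1))) • v)
    rw [key, map_smul, map_smul, inner_smul_right, norm_smul, mul_pow, smul_eq_mul, ← mul_sub,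
      ← ha, ← hb, Real.norm_eq_abs, sq_abs] at h1
    have h2 : -(a / (b + 1)) * a + 1 / 2 * ((-(a / (b + 1))) ^ 2 * b)
        = -(a ^ 2 * (b + 2)) / (2 * (b + 1) ^ 2) := by
      field_simp
      ring
    have h3 : 0 ≤ -(a ^ 2 * (b + 2)) / (2 * (b + 1) ^ 2) := by linarith
    have h4 : 0 ≤ -(a ^ 2 * (b + 2)) := by
      by_contra hneg
      exact absurd h3 (not_le.2 (div_neg_of_neg_of_pos (not_le.1 hneg) (by positivity)))
    have h5 : a ^ 2 = 0 := by nlinarith [sq_nonneg a]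
    exact sub_eq_zero.1 (pow_eq_zero_iff two_ne_zero |>.1 h5)
  · intro h v
    have h1 := key (v - u)
    rw [h, sub_self, add_sub_cancel] at h1
    rw [h1]
    nlinarith [sq_nonneg ‖T (v - u)‖]

theorem eq_of_forall_inner_apply_eq {T : E →L[ℝ] K} {c : ℝ} (hT : ∀ v, ‖v‖ ≤ c * ‖T v‖)
    {l : E →L[ℝ] ℝ} {u u' : E} (hu : ∀ v, inner ℝ (T u) (T v) = l v)
    (hu' : ∀ v, inner ℝ (T u') (T v) = l v) : u = u' := by
  have h : inner ℝ (T (u - u')) (T (u - u')) = 0 := by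
    rw [map_sub T u u', inner_sub_left, ← map_sub, hu, hu', sub_self]
  rw [inner_self_eq_zero] at h
  have h1 := hT (u - u')
  rw [h, norm_zero, mul_zero] at h1
  exact sub_eq_zero.1 (norm_le_zero_iff.1 h1)

end Riesz

/-! ### Passage to the closure of the smooth functions. -/

/-- Triples of a function, candidate weak partial derivatives, and a candidate trace. -/
abbrev TraceSpace (Ω : Set Plane) : Type := L2 Ω × (Fin 2 → L2 Ω) × BoundaryL2 Ω

theorem partialDeriv_add {φ ψ : Plane → ℝ} (hφ : ContDiff ℝ ∞ φ) (hψ : ContDiff ℝ ∞ ψ)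
    (i : Fin 2) (x : Plane) :
    partialDeriv i (φ + ψ) x = partialDeriv i φ x + partialDeriv i ψ x := by
  rw [partialDeriv, fderiv_add (hφ.differentiable (by simp) _) (hψ.differentiable (by simp) _)]
  rfl

theorem partialDeriv_const_smul (c : ℝ) {φ : Plane → ℝ} (hφ : ContDiff ℝ ∞ φ)
    (i : Fin 2) (x : Plane) : partialDeriv i (c • φ) x = c • partialDeriv i φ x := by
  rw [partialDeriv, fderiv_const_smul (hφ.differentiable (by simp) _)]
  rfl

/-- The smooth functions, with their partial derivatives and their restrictions to `∂Ω`. -/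
def smoothGraph (Ω : Set Plane) : Submodule ℝ (TraceSpace Ω) where
  carrier := {x | ∃ φ : Plane → ℝ, ContDiff ℝ ∞ φ ∧ x.1 =ᵐ[volume.restrict Ω] φ ∧
    (∀ i, x.2.1 i =ᵐ[volume.restrict Ω] partialDeriv i φ) ∧ x.2.2 =ᵐ[surfaceMeasure Ω] φ}
  add_mem' := by
    rintro x y ⟨φ, hφ, h1, h2, h3⟩ ⟨ψ, hψ, k1, k2, k3⟩
    refine ⟨φ + ψ, hφ.add hψ, (Lp.coeFn_add _ _).trans (h1.add k1), fun i => ?_,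
      (Lp.coeFn_add _ _).trans (h3.add k3)⟩
    refine (Lp.coeFn_add _ _).trans (((h2 i).add (k2 i)).trans (Eventually.of_forall fun z => ?_))
    exact (partialDeriv_add hφ hψ i z).symm
  zero_mem' := by
    refine ⟨0, contDiff_const, Lp.coeFn_zero _ _ _, fun i => ?_, Lp.coeFn_zero _ _ _⟩
    refine (Lp.coeFn_zero _ _ _).trans (Eventually.of_forall fun z => ?_)
    simp [partialDeriv]
  smul_mem' := by
    rintro c x ⟨φ, hφ, h1, h2, h3⟩
    refine ⟨c • φ, contDiff_const.smul hφ, (Lp.coeFn_smul _ _).trans (h1.const_smul c),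
      fun i => ?_, (Lp.coeFn_smul _ _).trans (h3.const_smul c)⟩
    refine (Lp.coeFn_smul _ _).trans (((h2 i).const_smul c).trans (Eventually.of_forall fun z => ?_))
    exact (partialDeriv_const_smul c hφ i z).symm

theorem memLp_two_restrict_of_continuous {μ : Measure Plane} {S : Set Plane} (hS : IsCompact S)
    [IsFiniteMeasure μ] (hμ : ∀ᵐ x ∂μ, x ∈ S) {f : Plane → ℝ} (hf : Continuous f) :
    MemLp f 2 μ := by
  obtain ⟨C, hC⟩ := hS.exists_bound_of_continuousOn hf.continuousOn
  exact MemLp.of_bound hf.aestronglyMeasurable C (hμ.mono fun x hx => hC x hx)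

/-- This turns traces into membership in the closure of a subspace, giving linearity and closedness
at once. Boundedness of `Ω` puts smooth functions and their derivatives in the `L²` spaces. -/
theorem hasTrace_iff_mem_closure {Ω : Set Plane} (hΩ : IsBoundedLipschitzDomain Ω) (u : H1 Ω)
    (w : BoundaryL2 Ω) :
    HasTrace u w ↔ ((u.1.1, u.1.2, w) : TraceSpace Ω) ∈ closure (smoothGraph Ω : Set (TraceSpace Ω)) := by
  have := isFiniteMeasure_surfaceMeasure hΩ
  have : IsFiniteMeasure ((volume : Measure Plane).restrict Ω) :=
    ⟨by rw [Measure.restrict_apply_univ]; exact hΩ.isBounded.measure_lt_top⟩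
  have hcl := hΩ.isBounded.isCompact_closure
  have hv : ∀ {f : Plane → ℝ}, Continuous f → MemLp f 2 (volume.restrict Ω) := fun hf =>
    memLp_two_restrict_of_continuous hcl
      ((ae_restrict_mem hΩ.isOpen.measurableSet).mono fun x hx => subset_closure hx) hf
  have hs : ∀ {f : Plane → ℝ}, Continuous f → MemLp f 2 (surfaceMeasure Ω) := fun hf =>
    memLp_two_restrict_of_continuous hcl
      ((ae_restrict_mem isClosed_frontier.measurableSet).mono
        fun x hx => frontier_subset_closure hx) hf
  rw [mem_closure_iff_seq_limit]
  constructor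
  · rintro ⟨φ, hφ, h1, h2, h3⟩
    have m1 := fun n => hv (hφ n).continuous
    have m2 := fun n i => hv (continuous_partialDeriv (hφ n) i)
    have m3 := fun n => hs (hφ n).continuous
    refine ⟨fun n => ((m1 n).toLp, fun i => (m2 n i).toLp, (m3 n).toLp),
      fun n => ⟨φ n, hφ n, (m1 n).coeFn_toLp, fun i => (m2 n i).coeFn_toLp, (m3 n).coeFn_toLp⟩, ?_⟩
    refine Tendsto.prodMk_nhds ?_ (Tendsto.prodMk_nhds (tendsto_pi_nhds.2 fun i => ?_) ?_)
    · rw [Lp.tendsto_Lp_iff_tendsto_eLpNorm']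
      refine h1.congr fun n => eLpNorm_congr_ae ?_
      filter_upwards [(m1 n).coeFn_toLp] with x hx
      rw [Pi.sub_apply, hx]; rfl
    · rw [Lp.tendsto_Lp_iff_tendsto_eLpNorm']
      refine (h2 i).congr fun n => eLpNorm_congr_ae ?_
      filter_upwards [(m2 n i).coeFn_toLp] with x hx
      rw [Pi.sub_apply, hx]; rfl
    · rw [Lp.tendsto_Lp_iff_tendsto_eLpNorm']
      refine h3.congr fun n => eLpNorm_congr_ae ?_
      filter_upwards [(m3 n).coeFn_toLp] with x hx
      rw [Pi.sub_apply, hx]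
  · rintro ⟨x, hx, hlim⟩
    choose φ hφ h1 h2 h3 using hx
    have l1 := (continuous_fst.tendsto _).comp hlim
    have l2 : ∀ i, Tendsto (fun n => (x n).2.1 i) atTop (𝓝 (u.1.2 i)) := fun i =>
      tendsto_pi_nhds.1 ((continuous_fst.tendsto _).comp ((continuous_snd.tendsto _).comp hlim)) i
    have l3 := (continuous_snd.tendsto _).comp ((continuous_snd.tendsto _).comp hlim)
    refine ⟨φ, hφ, ?_, fun i => ?_, ?_⟩
    · refine ((Lp.tendsto_Lp_iff_tendsto_eLpNorm' _ _).1 l1).congr fun n => eLpNorm_congr_ae ?_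
      filter_upwards [h1 n] with y hy
      rw [Pi.sub_apply, Function.comp_apply, hy]; rfl
    · refine ((Lp.tendsto_Lp_iff_tendsto_eLpNorm' _ _).1 (l2 i)).congr fun n => eLpNorm_congr_ae ?_
      filter_upwards [h2 n i] with y hy
      rw [Pi.sub_apply, hy]; rfl
    · refine ((Lp.tendsto_Lp_iff_tendsto_eLpNorm' _ _).1 l3).congr fun n => eLpNorm_congr_ae ?_
      filter_upwards [h3 n] with y hy
      rw [Pi.sub_apply, Function.comp_apply, Function.comp_apply, hy]

theorem enorm_sq_eq_lintegral {X : Type*} [MeasurableSpace X] {μ : Measure X} (f : Lp ℝ 2 μ) :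
    ‖f‖ₑ ^ 2 = ∫⁻ x, ‖f x‖ₑ ^ 2 ∂μ := by
  rw [Lp.enorm_def, eLpNorm_eq_lintegral_rpow_enorm_toReal two_ne_zero ENNReal.ofNat_ne_top,
    ← ENNReal.rpow_natCast, ← ENNReal.rpow_mul]
  simp

theorem enorm_sq_eq_lintegral_of_ae_eq {X : Type*} [MeasurableSpace X] {μ : Measure X}
    {f : Lp ℝ 2 μ} {φ : X → ℝ} (h : f =ᵐ[μ] φ) : ‖f‖ₑ ^ 2 = ∫⁻ x, ‖φ x‖ₑ ^ 2 ∂μ := by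
  rw [enorm_sq_eq_lintegral]
  exact lintegral_congr_ae (h.mono fun x hx => by beta_reduce; rw [hx])

theorem enorm_sq_fderiv_le (φ : Plane → ℝ) (x : Plane) :
    ‖fderiv ℝ φ x‖ₑ ^ 2
      ≤ 2 * ‖partialDeriv 0 φ x‖ₑ ^ 2 + 2 * ‖partialDeriv 1 φ x‖ₑ ^ 2 := by
  refine le_trans ?_ (ennreal_add_sq_le _ _)
  gcongr
  have h : ‖fderiv ℝ φ x‖ ≤ ‖partialDeriv 0 φ x‖ + ‖partialDeriv 1 φ x‖ := by
    refine ContinuousLinearMap.opNorm_le_bound _ (by positivity) fun v => ?_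
    have hv : v = v 0 • EuclideanSpace.single 0 1 + v 1 • EuclideanSpace.single 1 1 := by
      ext i
      fin_cases i <;> simp
    conv_lhs => rw [hv]
    rw [map_add, map_smul, map_smul, add_mul]
    refine (norm_add_le _ _).trans (add_le_add ?_ ?_)
    · rw [norm_smul, mul_comm]
      exact mul_le_mul_of_nonneg_left (PiLp.norm_apply_le v 0) (norm_nonneg _)
    · rw [norm_smul, mul_comm]
      exact mul_le_mul_of_nonneg_left (PiLp.norm_apply_le v 1) (norm_nonneg _)
  rw [enorm_eq_nnnorm, enorm_eq_nnnorm, enorm_eq_nnnorm]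
  exact_mod_cast h

theorem setLIntegral_enorm_sq_fderiv_le {Ω : Set Plane} {φ : Plane → ℝ} (hφ : ContDiff ℝ ∞ φ)
    {p : Fin 2 → L2 Ω} (hp : ∀ i, p i =ᵐ[volume.restrict Ω] partialDeriv i φ) :
    ∫⁻ x in Ω, ‖fderiv ℝ φ x‖ₑ ^ 2 ≤ 2 * ‖p 0‖ₑ ^ 2 + 2 * ‖p 1‖ₑ ^ 2 := by
  have hm : ∀ i, Measurable fun x => ‖partialDeriv i φ x‖ₑ ^ 2 := fun i =>
    (continuous_partialDeriv hφ i).enorm.measurable.pow_const _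
  rw [enorm_sq_eq_lintegral_of_ae_eq (hp 0), enorm_sq_eq_lintegral_of_ae_eq (hp 1),
    ← lintegral_const_mul _ (hm 0), ← lintegral_const_mul _ (hm 1),
    ← lintegral_add_left ((hm 0).const_mul _)]
  exact lintegral_mono fun x => enorm_sq_fderiv_le φ x

/-- The trace inequality on the closure of the smooth functions. -/
theorem exists_norm_sq_trace_le {Ω : Set Plane} (hΩ : IsBoundedLipschitzDomain Ω) :
    ∃ C : ℝ≥0, ∀ x ∈ closure (smoothGraph Ω : Set (TraceSpace Ω)),
      ‖x.2.2‖ ^ 2 ≤ C * (‖x.1‖ ^ 2 + (2 * ‖x.2.1 0‖ ^ 2 + 2 * ‖x.2.1 1‖ ^ 2)) := by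
  obtain ⟨C, hC, h⟩ := exists_trace_bound hΩ
  lift C to ℝ≥0 using hC
  refine ⟨C, fun x hx => ?_⟩
  -- Both sides are continuous on triples, so the inequality defines a closed set and only smooth
  -- triples need checking.
  refine closure_minimal (t := {x : TraceSpace Ω | ‖x.2.2‖ ^ 2
    ≤ C * (‖x.1‖ ^ 2 + (2 * ‖x.2.1 0‖ ^ 2 + 2 * ‖x.2.1 1‖ ^ 2))}) ?_
    (isClosed_le (by fun_prop) (by fun_prop)) hx
  rintro y ⟨φ, hφ, h1, h2, h3⟩
  have h4 := (h ⟨φ, hφ⟩).trans (mul_le_mul' le_rfl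
    (add_le_add le_rfl (setLIntegral_enorm_sq_fderiv_le hφ h2)))
  rw [← enorm_sq_eq_lintegral_of_ae_eq h1, ← enorm_sq_eq_lintegral_of_ae_eq h3] at h4
  simp only [enorm_eq_nnnorm] at h4
  simp only [Set.mem_ofPred_eq, ← coe_nnnorm]
  exact_mod_cast h4

/-- Restriction of functions on `∂Ω` to a part of the boundary. -/
def restrictBoundary {Ω : Set Plane} (A : Set Plane) :
    BoundaryL2 Ω →L[ℝ] Lp ℝ 2 ((surfaceMeasure Ω).restrict A) :=
  LpToLpRestrictCLM Plane ℝ ℝ (surfaceMeasure Ω) 2 A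

theorem coeFn_restrictBoundary {Ω : Set Plane} (A : Set Plane) (w : BoundaryL2 Ω) :
    restrictBoundary A w =ᵐ[(surfaceMeasure Ω).restrict A] w :=
  LpToLpRestrictCLM_coeFn ℝ A w

/-- The Friedrichs inequality on the closure of the smooth functions. -/
theorem exists_norm_sq_le {Ω ΓD : Set Plane} (hΩ : IsBoundedLipschitzDomain Ω)
    (hsub : ΓD ⊆ frontier Ω) (hclosed : IsClosed ΓD)
    (hint : ∃ z ∈ ΓD, ∃ r : ℝ, 0 < r ∧ Metric.ball z r ∩ frontier Ω ⊆ ΓD) :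
    ∃ C : ℝ≥0, ∀ x ∈ closure (smoothGraph Ω : Set (TraceSpace Ω)),
      ‖x.1‖ ^ 2 ≤ C * (‖restrictBoundary ΓD x.2.2‖ ^ 2
        + (2 * ‖x.2.1 0‖ ^ 2 + 2 * ‖x.2.1 1‖ ^ 2)) := by
  obtain ⟨C, hC, h⟩ := exists_friedrichs_bound hΩ hsub hint
  lift C to ℝ≥0 using hC
  refine ⟨C, fun x hx => ?_⟩
  refine closure_minimal (t := {x : TraceSpace Ω | ‖x.1‖ ^ 2
    ≤ C * (‖restrictBoundary ΓD x.2.2‖ ^ 2 + (2 * ‖x.2.1 0‖ ^ 2 + 2 * ‖x.2.1 1‖ ^ 2))}) ?_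
    (isClosed_le (by fun_prop) (by fun_prop)) hx
  rintro y ⟨φ, hφ, h1, h2, h3⟩
  have h4 := (h ⟨φ, hφ⟩).trans (mul_le_mul' le_rfl
    (add_le_add le_rfl (setLIntegral_enorm_sq_fderiv_le hφ h2)))
  have h5 := enorm_sq_eq_lintegral_of_ae_eq
    ((coeFn_restrictBoundary ΓD y.2.2).trans (ae_restrict_of_ae h3))
  have hμ : (surfaceMeasure Ω).restrict ΓD = (Measure.hausdorffMeasure 1).restrict ΓD := by
    rw [Measure.restrict_restrict hclosed.measurableSet, inter_eq_left.2 hsub]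
  replace h5 := h5.trans (congrArg (fun μ : Measure Plane => ∫⁻ x, ‖φ x‖ₑ ^ 2 ∂μ) hμ)
  rw [← enorm_sq_eq_lintegral_of_ae_eq h1, ← h5] at h4
  simp only [enorm_eq_nnnorm] at h4
  simp only [Set.mem_ofPred_eq, ← coe_nnnorm]
  exact_mod_cast h4

/-- The difference of the two triples is `(0, 0, w - w')` and still lies in the closure, where the
trace inequality forces `w = w'`. -/
theorem HasTrace.unique {Ω : Set Plane} (hΩ : IsBoundedLipschitzDomain Ω) {u : H1 Ω}
    {w w' : BoundaryL2 Ω} (h : HasTrace u w) (h' : HasTrace u w') : w = w' := by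
  rw [hasTrace_iff_mem_closure hΩ, ← Submodule.topologicalClosure_coe] at h h'
  have hd := Submodule.sub_mem _ h h'
  rw [← SetLike.mem_coe, Submodule.topologicalClosure_coe] at hd
  obtain ⟨C, hC⟩ := exists_norm_sq_trace_le hΩ
  have h1 := hC _ hd
  simp only [Prod.mk_sub_mk, sub_self, Pi.zero_apply, norm_zero] at h1
  have h2 : ‖w - w'‖ ^ 2 = 0 := le_antisymm (by simpa using h1) (by positivity)
  exact sub_eq_zero.1 (norm_eq_zero.1 (pow_eq_zero_iff two_ne_zero |>.1 h2))

theorem HasTrace.trace_eq {Ω : Set Plane} (hΩ : IsBoundedLipschitzDomain Ω) {u : H1 Ω}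
    {w : BoundaryL2 Ω} (h : HasTrace u w) : trace u = w := by
  have hex : ∃ w, HasTrace u w := ⟨w, h⟩
  rw [trace, dif_pos hex]
  exact hex.choose_spec.unique hΩ h

theorem integral_mul_eq_inner {Ω : Set Plane} (u : L2 Ω) {f : Plane → ℝ}
    (hf : MemLp f 2 (volume.restrict Ω)) : ∫ x in Ω, u x * f x = inner ℝ (hf.toLp f) u := by
  rw [L2.inner_def]
  refine integral_congr_ae ?_
  filter_upwards [hf.coeFn_toLp] with x hx
  rw [hx]
  rfl

/-- Each test function imposes one equation between `L²` inner products, which is a closed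
condition. -/
theorem isClosed_H1 (Ω : Set Plane) : IsClosed (H1 Ω : Set (L2 Ω × (Fin 2 → L2 Ω))) := by
  have : (H1 Ω : Set (L2 Ω × (Fin 2 → L2 Ω))) = ⋂ (i : Fin 2) (φ : Plane → ℝ)
      (_ : ContDiff ℝ ∞ φ) (_ : HasCompactSupport φ) (_ : tsupport φ ⊆ Ω),
      {u | ∫ x in Ω, u.1 x * partialDeriv i φ x = -∫ x in Ω, u.2 i x * φ x} := by
    ext u
    simp only [mem_iInter]
    rfl
  rw [this]
  refine isClosed_iInter fun i => isClosed_iInter fun φ => isClosed_iInter fun hφ =>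
    isClosed_iInter fun hs => isClosed_iInter fun _ => ?_
  have m1 : MemLp φ 2 (volume.restrict Ω) :=
    (hφ.continuous.memLp_of_hasCompactSupport hs).restrict Ω
  have m2 : MemLp (partialDeriv i φ) 2 (volume.restrict Ω) :=
    ((continuous_partialDeriv hφ i).memLp_of_hasCompactSupport
      (hasCompactSupport_partialDeriv hs i)).restrict Ω
  simp only [integral_mul_eq_inner _ m1, integral_mul_eq_inner _ m2]
  exact isClosed_eq (by fun_prop) (by fun_prop)

/-! ### The space of clamped fields and its coercivity. -/

/-- The `H¹` functions that vanish on `Γ_D`, with their weak derivatives and their traces. -/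
def clampedGraph (Ω ΓD : Set Plane) : Submodule ℝ (TraceSpace Ω) :=
  (smoothGraph Ω).topologicalClosure
    ⊓ (H1 Ω).comap ((LinearMap.fst ℝ _ _).prod
      ((LinearMap.fst ℝ _ _).comp (LinearMap.snd ℝ _ _)))
    ⊓ LinearMap.ker ((restrictBoundary ΓD).toLinearMap.comp
      ((LinearMap.snd ℝ _ _).comp (LinearMap.snd ℝ _ _)))

theorem mem_clampedGraph {Ω ΓD : Set Plane} {x : TraceSpace Ω} :
    x ∈ clampedGraph Ω ΓD ↔ x ∈ closure (smoothGraph Ω : Set (TraceSpace Ω)) ∧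
      (x.1, x.2.1) ∈ H1 Ω ∧ restrictBoundary ΓD x.2.2 = 0 := by
  rw [← and_assoc]
  rfl

theorem isClosed_clampedGraph (Ω ΓD : Set Plane) :
    IsClosed (clampedGraph Ω ΓD : Set (TraceSpace Ω)) := by
  have : (clampedGraph Ω ΓD : Set (TraceSpace Ω)) = closure (smoothGraph Ω : Set (TraceSpace Ω)) ∩
      ((fun x : TraceSpace Ω => (x.1, x.2.1)) ⁻¹' (H1 Ω : Set (L2 Ω × (Fin 2 → L2 Ω))) ∩
        {x | restrictBoundary ΓD x.2.2 = 0}) :=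
    Set.ext fun x => mem_clampedGraph
  rw [this]
  exact isClosed_closure.inter (((isClosed_H1 Ω).preimage (by fun_prop)).inter
    (isClosed_eq (by fun_prop) (by fun_prop)))

theorem restrictBoundary_eq_zero_iff {Ω ΓD : Set Plane} (hsub : ΓD ⊆ frontier Ω)
    (hclosed : IsClosed ΓD) (w : BoundaryL2 Ω) :
    restrictBoundary ΓD w = 0 ↔
      ∀ᵐ x ∂(Measure.hausdorffMeasure 1 : Measure Plane).restrict ΓD, w x = 0 := by
  have hμ : (surfaceMeasure Ω).restrict ΓD = (Measure.hausdorffMeasure 1).restrict ΓD := by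
    rw [Measure.restrict_restrict hclosed.measurableSet, inter_eq_left.2 hsub]
  rw [Lp.eq_zero_iff_ae_eq_zero, ← hμ]
  have h := coeFn_restrictBoundary ΓD w
  exact ⟨fun h0 => h.symm.trans h0, fun h0 => h.trans h0⟩

/-- The gradient controls the norm of a clamped function. -/
theorem exists_norm_le_of_mem_clampedGraph {Ω ΓD : Set Plane} (hΩ : IsBoundedLipschitzDomain Ω)
    (hsub : ΓD ⊆ frontier Ω) (hclosed : IsClosed ΓD)
    (hint : ∃ z ∈ ΓD, ∃ r : ℝ, 0 < r ∧ Metric.ball z r ∩ frontier Ω ⊆ ΓD) :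
    ∃ C : ℝ≥0, ∀ x ∈ clampedGraph Ω ΓD, ‖x‖ ^ 2 ≤ C * (‖x.2.1 0‖ ^ 2 + ‖x.2.1 1‖ ^ 2) := by
  obtain ⟨C₁, h₁⟩ := exists_norm_sq_trace_le hΩ
  obtain ⟨C₂, h₂⟩ := exists_norm_sq_le hΩ hsub hclosed hint
  -- The three summands bound the function, the derivatives and the trace; the product norm is a
  -- maximum, so their sum dominates.
  refine ⟨2 * C₂ + 1 + C₁ * (2 * C₂ + 2), fun x hx => ?_⟩
  obtain ⟨hx1, -, hx2⟩ := mem_clampedGraph.1 hx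
  have k1 := h₁ x hx1
  have k2 := h₂ x hx1
  rw [hx2, norm_zero] at k2
  set G := ‖x.2.1 0‖ ^ 2 + ‖x.2.1 1‖ ^ 2 with hG
  have hG0 : 0 ≤ G := by positivity
  have c1 : (0 : ℝ) ≤ C₁ := C₁.coe_nonneg
  have c2 : (0 : ℝ) ≤ C₂ := C₂.coe_nonneg
  have b1 : ‖x.1‖ ^ 2 ≤ 2 * C₂ * G := by rw [hG]; linarith
  have b3 : ‖x.2.2‖ ^ 2 ≤ C₁ * (2 * C₂ + 2) * G := by
    refine k1.trans ?_
    rw [mul_assoc]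
    refine mul_le_mul_of_nonneg_left ?_ c1
    rw [hG] at b1 ⊢
    linarith
  have b2 : ∀ i, ‖x.2.1 i‖ ^ 2 ≤ G := by
    intro i
    fin_cases i
    · exact le_add_of_nonneg_right (by positivity)
    · exact le_add_of_nonneg_left (by positivity)
  push_cast
  set D : ℝ := 2 * C₂ + 1 + C₁ * (2 * C₂ + 2) with hD
  have hD0 : 0 ≤ D := by positivity
  have e1 : 2 * C₂ * G ≤ D * G := mul_le_mul_of_nonneg_right (by rw [hD]; nlinarith) hG0
  have e2 : G ≤ D * G := le_mul_of_one_le_left hG0 (by rw [hD]; nlinarith)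
  have e3 : C₁ * (2 * C₂ + 2) * G ≤ D * G :=
    mul_le_mul_of_nonneg_right (by rw [hD]; nlinarith) hG0
  have hle : ‖x‖ ≤ √(D * G) := by
    rw [Prod.norm_def, Prod.norm_def]
    refine max_le (Real.le_sqrt_of_sq_le (b1.trans e1))
      (max_le ?_ (Real.le_sqrt_of_sq_le (b3.trans e3)))
    exact (pi_norm_le_iff_of_nonneg (Real.sqrt_nonneg _)).2
      fun i => Real.le_sqrt_of_sq_le ((b2 i).trans e2)
  calc ‖x‖ ^ 2 ≤ √(D * G) ^ 2 := by gcongr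
    _ = D * G := Real.sq_sqrt (by positivity)

section ClampedFields

variable {Ω ΓD : Set Plane}

/-- The clamped vector fields, with their weak derivatives and their traces. -/
abbrev ClampedField (Ω ΓD : Set Plane) : Type := Fin 2 → clampedGraph Ω ΓD

/-- The `H¹` field underlying a clamped field. -/
def ClampedField.toH1 (v : ClampedField Ω ΓD) : Fin 2 → H1 Ω :=
  fun j => ⟨((v j).1.1, (v j).1.2.1), (mem_clampedGraph.1 (v j).2).2.1⟩

theorem ClampedField.hasTrace (hΩ : IsBoundedLipschitzDomain Ω) (v : ClampedField Ω ΓD)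
    (j : Fin 2) : HasTrace (v.toH1 j) (v j).1.2.2 :=
  (hasTrace_iff_mem_closure hΩ _ _).2 (mem_clampedGraph.1 (v j).2).1

theorem mem_clampedH1_iff (hΩ : IsBoundedLipschitzDomain Ω) (hsub : ΓD ⊆ frontier Ω)
    (hclosed : IsClosed ΓD) (u : Fin 2 → H1 Ω) :
    u ∈ clampedH1 Ω ΓD ↔ ∃ v : ClampedField Ω ΓD, v.toH1 = u := by
  constructor
  · intro hu
    choose w hw hw0 using hu
    exact ⟨fun j => ⟨((u j).1.1, (u j).1.2, w j), mem_clampedGraph.2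
      ⟨(hasTrace_iff_mem_closure hΩ _ _).1 (hw j), (u j).2,
        (restrictBoundary_eq_zero_iff hsub hclosed _).2 (hw0 j)⟩⟩, rfl⟩
  · rintro ⟨v, rfl⟩ j
    exact ⟨_, v.hasTrace hΩ j, (restrictBoundary_eq_zero_iff hsub hclosed _).1
      (mem_clampedGraph.1 (v j).2).2.2⟩

/-- The weak partial derivative `∂ⱼ vᵢ` of a clamped field. -/
def clampedPartial (i j : Fin 2) : ClampedField Ω ΓD →L[ℝ] L2 Ω :=
  (ContinuousLinearMap.proj j).comp ((ContinuousLinearMap.fst ℝ _ _).comp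
    ((ContinuousLinearMap.snd ℝ _ _).comp ((clampedGraph Ω ΓD).subtypeL.comp
      (ContinuousLinearMap.proj (φ := fun _ : Fin 2 => clampedGraph Ω ΓD) i))))

/-- The trace of the component `vⱼ` of a clamped field. -/
def clampedTrace (j : Fin 2) : ClampedField Ω ΓD →L[ℝ] BoundaryL2 Ω :=
  (ContinuousLinearMap.snd ℝ _ _).comp
    ((ContinuousLinearMap.snd ℝ _ _).comp ((clampedGraph Ω ΓD).subtypeL.comp
      (ContinuousLinearMap.proj (φ := fun _ : Fin 2 => clampedGraph Ω ΓD) j)))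

/-- The operator `v ↦ (Cv, √α ∂v)`. -/
def energyOperator (Ω ΓD : Set Plane) (α : ℝ) :
    ClampedField Ω ΓD →L[ℝ] PiLp 2 fun _ : Fin 2 ⊕ Fin 2 × Fin 2 => L2 Ω :=
  (PiLp.continuousLinearEquiv 2 ℝ
      fun _ : Fin 2 ⊕ Fin 2 × Fin 2 => L2 Ω).symm.toContinuousLinearMap.comp
    (ContinuousLinearMap.pi (Sum.elim
      ![-clampedPartial 0 0 + clampedPartial 1 1, clampedPartial 0 1 + clampedPartial 1 0]
      fun p => √α • clampedPartial p.1 p.2))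

theorem energyOperator_inl (α : ℝ) (v : ClampedField Ω ΓD) (i : Fin 2) :
    energyOperator Ω ΓD α v (Sum.inl i) = cauchyRiemann v.toH1 i := by
  fin_cases i <;> rfl

theorem energyOperator_inr (α : ℝ) (v : ClampedField Ω ΓD) (i j : Fin 2) :
    energyOperator Ω ΓD α v (Sum.inr (i, j)) = √α • jacobian v.toH1 i j :=
  rfl

theorem inner_energyOperator {α : ℝ} (hα : 0 ≤ α) (u v : ClampedField Ω ΓD) :
    inner ℝ (energyOperator Ω ΓD α u) (energyOperator Ω ΓD α v)
      = (∑ i, inner ℝ (cauchyRiemann u.toH1 i) (cauchyRiemann v.toH1 i))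
        + α * ∑ i, ∑ j, inner ℝ (jacobian u.toH1 i j) (jacobian v.toH1 i j) := by
  rw [PiLp.inner_apply, Fintype.sum_sum_type, Fintype.sum_prod_type]
  simp only [energyOperator_inl, energyOperator_inr, inner_smul_left, inner_smul_right,
    conj_trivial, ← mul_assoc, Real.mul_self_sqrt hα, Finset.mul_sum]

theorem norm_sq_energyOperator {α : ℝ} (hα : 0 ≤ α) (v : ClampedField Ω ΓD) :
    ‖energyOperator Ω ΓD α v‖ ^ 2 = (∑ i, ‖cauchyRiemann v.toH1 i‖ ^ 2)
      + α * ∑ i, ∑ j, ‖jacobian v.toH1 i j‖ ^ 2 := by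
  simp only [← real_inner_self_eq_norm_sq, inner_energyOperator hα]

/-- The load functional `v ↦ ∫_Γ g · v ds`. -/
def loadFunctional (ΓD : Set Plane) (g : Fin 2 → BoundaryL2 Ω) : ClampedField Ω ΓD →L[ℝ] ℝ :=
  ∑ j, (innerSL ℝ (restrictBoundary ΓDᶜ (g j))).comp ((restrictBoundary ΓDᶜ).comp (clampedTrace j))

/-- The trace picked by choice equals the stored third coordinate, by uniqueness, so the load
becomes a continuous linear functional of the triple. -/
theorem boundaryLoad_toH1 (hΩ : IsBoundedLipschitzDomain Ω) (hclosed : IsClosed ΓD)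
    (g : Fin 2 → BoundaryL2 Ω) (v : ClampedField Ω ΓD) :
    boundaryLoad ΓD g v.toH1 = loadFunctional ΓD g v := by
  have hμ : (surfaceMeasure Ω).restrict ΓDᶜ
      = (Measure.hausdorffMeasure 1).restrict (frontier Ω \ ΓD) := by
    rw [Measure.restrict_restrict hclosed.measurableSet.compl, inter_comm, sdiff_eq]
  have ht : ∀ j, trace (v.toH1 j) = clampedTrace j v := fun j => (v.hasTrace hΩ j).trace_eq hΩ
  have hint : ∀ j, Integrable (fun x => g j x * clampedTrace j v x)
      ((surfaceMeasure Ω).restrict ΓDᶜ) := fun j =>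
    ((Lp.memLp (g j)).integrable_mul (Lp.memLp (clampedTrace j v))).restrict
  rw [boundaryLoad, ← hμ]
  simp only [ht]
  rw [integral_finsetSum _ fun j _ => hint j, loadFunctional, _root_.sum_apply]
  refine Finset.sum_congr rfl fun j _ => ?_
  rw [ContinuousLinearMap.comp_apply, ContinuousLinearMap.comp_apply, innerSL_apply_apply,
    L2.inner_def]
  refine integral_congr_ae ?_
  filter_upwards [coeFn_restrictBoundary ΓDᶜ (g j),
    coeFn_restrictBoundary ΓDᶜ (clampedTrace j v)] with x h1 h2
  rw [h1, h2]
  exact mul_comm _ _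

/-- Only the term `α‖∂v‖²` is needed for coercivity; the Cauchy–Riemann term is nonnegative and is
dropped. -/
theorem exists_norm_le_energyOperator (hΩ : IsBoundedLipschitzDomain Ω)
    (hsub : ΓD ⊆ frontier Ω) (hclosed : IsClosed ΓD)
    (hint : ∃ z ∈ ΓD, ∃ r : ℝ, 0 < r ∧ Metric.ball z r ∩ frontier Ω ⊆ ΓD) {α : ℝ} (hα : 0 < α) :
    ∃ C : ℝ≥0, ∀ v : ClampedField Ω ΓD, ‖v‖ ≤ C * ‖energyOperator Ω ΓD α v‖ := by
  obtain ⟨C, hC⟩ := exists_norm_le_of_mem_clampedGraph hΩ hsub hclosed hint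
  refine ⟨NNReal.sqrt (C / α.toNNReal), fun v => ?_⟩
  refine (pi_norm_le_iff_of_nonneg (by positivity)).2 fun i => ?_
  refine le_of_sq_le_sq ?_ (by positivity)
  have h1 : ‖v i‖ ^ 2 ≤ C * ∑ j, ‖jacobian v.toH1 i j‖ ^ 2 := by
    rw [Fin.sum_univ_two]
    exact hC _ (v i).2
  have h2 : ∑ j, ‖jacobian v.toH1 i j‖ ^ 2 ≤ ∑ i, ∑ j, ‖jacobian v.toH1 i j‖ ^ 2 :=
    Finset.single_le_sum (f := fun i => ∑ j, ‖jacobian v.toH1 i j‖ ^ 2)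
      (fun i _ => Finset.sum_nonneg fun j _ => by positivity) (Finset.mem_univ i)
  have h3 : α * ∑ i, ∑ j, ‖jacobian v.toH1 i j‖ ^ 2 ≤ ‖energyOperator Ω ΓD α v‖ ^ 2 := by
    rw [norm_sq_energyOperator hα.le]
    exact le_add_of_nonneg_left (Finset.sum_nonneg fun i _ => by positivity)
  rw [mul_pow, ← NNReal.coe_pow, NNReal.sq_sqrt, NNReal.coe_div, Real.coe_toNNReal α hα.le,
    div_mul_eq_mul_div, le_div_iff₀ hα]
  calc ‖v i‖ ^ 2 * α ≤ (C * ∑ j, ‖jacobian v.toH1 i j‖ ^ 2) * α := by gcongr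
    _ ≤ (C * ∑ i, ∑ j, ‖jacobian v.toH1 i j‖ ^ 2) * α := by gcongr
    _ = C * (α * ∑ i, ∑ j, ‖jacobian v.toH1 i j‖ ^ 2) := by ring
    _ ≤ _ := by gcongr

theorem energy_toH1 (hΩ : IsBoundedLipschitzDomain Ω) (hclosed : IsClosed ΓD)
    (g : Fin 2 → BoundaryL2 Ω) {α : ℝ} (hα : 0 ≤ α) (v : ClampedField Ω ΓD) :
    energy ΓD g α v.toH1
      = 1 / 2 * ‖energyOperator Ω ΓD α v‖ ^ 2 - (α • loadFunctional ΓD g) v := by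
  rw [energy, norm_sq_energyOperator hα, boundaryLoad_toH1 hΩ hclosed]
  rfl

theorem isMinimiser_toH1_iff (hΩ : IsBoundedLipschitzDomain Ω) (hsub : ΓD ⊆ frontier Ω)
    (hclosed : IsClosed ΓD) (g : Fin 2 → BoundaryL2 Ω) {α : ℝ} (hα : 0 ≤ α)
    (u : ClampedField Ω ΓD) :
    IsMinimiser ΓD g α u.toH1 ↔ ∀ v, inner ℝ (energyOperator Ω ΓD α u) (energyOperator Ω ΓD α v)
      = (α • loadFunctional ΓD g) v := by
  rw [← half_norm_sq_sub_le_iff]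
  simp only [← energy_toH1 hΩ hclosed g hα]
  refine ⟨fun h v => h.2 _ ((mem_clampedH1_iff hΩ hsub hclosed _).2 ⟨v, rfl⟩),
    fun h => ⟨(mem_clampedH1_iff hΩ hsub hclosed _).2 ⟨u, rfl⟩, fun v hv => ?_⟩⟩
  obtain ⟨v, rfl⟩ := (mem_clampedH1_iff hΩ hsub hclosed _).1 hv
  exact h v

theorem isWeakSolution_toH1_iff (hΩ : IsBoundedLipschitzDomain Ω) (hsub : ΓD ⊆ frontier Ω)
    (hclosed : IsClosed ΓD) (g : Fin 2 → BoundaryL2 Ω) {α : ℝ} (hα : 0 ≤ α)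
    (u : ClampedField Ω ΓD) :
    IsWeakSolution ΓD g α u.toH1 ↔
      ∀ v, inner ℝ (energyOperator Ω ΓD α u) (energyOperator Ω ΓD α v)
        = (α • loadFunctional ΓD g) v := by
  have hv : ∀ v : ClampedField Ω ΓD,
      (α • loadFunctional ΓD g) v = α * boundaryLoad ΓD g v.toH1 := fun v => by
    rw [boundaryLoad_toH1 hΩ hclosed]; rfl
  simp only [inner_energyOperator hα, hv]
  refine ⟨fun h v => h.2 _ ((mem_clampedH1_iff hΩ hsub hclosed _).2 ⟨v, rfl⟩),
    fun h => ⟨(mem_clampedH1_iff hΩ hsub hclosed _).2 ⟨u, rfl⟩, fun v hv => ?_⟩⟩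
  obtain ⟨v, rfl⟩ := (mem_clampedH1_iff hΩ hsub hclosed _).1 hv
  exact h v

end ClampedFields

end CRLeastSquares

end
-- Existence, uniqueness and the variational characterisation.
theorem mainTheorem7
    (Ω ΓD : Set CRLeastSquares.Plane)
    (hΩ : CRLeastSquares.IsBoundedLipschitzDomain Ω)
    (hsub : ΓD ⊆ frontier Ω)
    (hclosed : IsClosed ΓD)
    (hpos : 0 < (Measure.hausdorffMeasure 1 : Measure CRLeastSquares.Plane) ΓD)
    (hcomp : Finite (ConnectedComponents ΓD))
    (hint : ∃ z ∈ ΓD, ∃ r : ℝ, 0 < r ∧ Metric.ball z r ∩ frontier Ω ⊆ ΓD)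
    (g : Fin 2 → CRLeastSquares.BoundaryL2 Ω)
    (α : ℝ) (hα : 0 < α) :
    (∃! u : Fin 2 → CRLeastSquares.H1 Ω, CRLeastSquares.IsMinimiser ΓD g α u) ∧
    ∀ u : Fin 2 → CRLeastSquares.H1 Ω,
      CRLeastSquares.IsMinimiser ΓD g α u ↔ CRLeastSquares.IsWeakSolution ΓD g α u := by
  open CRLeastSquares in
  have hex : ∀ {u}, IsMinimiser ΓD g α u ∨ IsWeakSolution ΓD g α u →
      ∃ v : ClampedField Ω ΓD, v.toH1 = u := fun h =>
    (mem_clampedH1_iff hΩ hsub hclosed _).1 (h.elim And.left And.left)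
  have hmin := CRLeastSquares.isMinimiser_toH1_iff hΩ hsub hclosed g hα.le
  have hweak := CRLeastSquares.isWeakSolution_toH1_iff hΩ hsub hclosed g hα.le
  obtain ⟨C, hC⟩ := CRLeastSquares.exists_norm_le_energyOperator hΩ hsub hclosed hint hα
  have : CompleteSpace (CRLeastSquares.clampedGraph Ω ΓD) :=
    (CRLeastSquares.isClosed_clampedGraph Ω ΓD).completeSpace_coe
  obtain ⟨u, hu⟩ := CRLeastSquares.exists_forall_inner_apply_eq
    (CRLeastSquares.energyOperator Ω ΓD α) hC (α • CRLeastSquares.loadFunctional ΓD g)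
  refine ⟨⟨u.toH1, (hmin u).2 hu, fun u' hu' => ?_⟩, fun u' => ⟨fun h => ?_, fun h => ?_⟩⟩
  · obtain ⟨v, rfl⟩ := hex (Or.inl hu')
    rw [CRLeastSquares.eq_of_forall_inner_apply_eq hC ((hmin v).1 hu') hu]
  · obtain ⟨v, rfl⟩ := hex (Or.inl h)
    exact (hweak v).2 ((hmin v).1 h)
  · obtain ⟨v, rfl⟩ := hex (Or.inr h)
    exact (hmin v).2 ((hweak v).1 h)
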